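/- Let $G$ be a crystallographic group of type $R\overline{3}\frac{2}{c}$ (No. 167), i.e. a group of isometries of Euclidean space $\mathbb{R}^3$ that some affine change of coordinates carries onto the group generated by the translations by $(1,0,0)$, $(0,1,0)$, $(0,0,1)$, $(\tfrac23,\tfrac13,\tfrac13)$ and the maps $(x,y,z)\mapsto(-y,x-y,z)$, $(x,y,z)\mapsto(y,x,-z+\tfrac12)$ and $(x,y,z)\mapsto(-x,-y,-z)$. For $P\in\mathbb{R}^3$ and $Q\in GP$ let $\mathrm{Vor}_{GP}(Q)$ be the closed Voronoi region of $Q$ in the Voronoi diagram of the orbit $GP$. Then for every point $P\in\mathbb{R}^3$ the Dirichlet stereohedron $\mathrm{Vor}_{GP}(P)$ has at most $31+48=79$ facets (two-dimensional faces); that is, $P$ has at most $79$ neighbours, where a neighbour of $P$ is a point $Q\in GP$, $Q\ne P$, such that $\mathrm{Vor}_{GP}(P)$ and $\mathrm{Vor}_{GP}(Q)$ share a facet. -/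

import Mathlib

noncomputable section

/-- Euclidean 3-space. -/
abbrev E3 : Type := EuclideanSpace ℝ (Fin 3)

/-! ### Voronoi regions, facets, neighbours -/

/-- The closed Voronoi region of the point `P` with respect to the point set `S`. -/
def voronoiRegion (S : Set E3) (P : E3) : Set E3 :=
  {x | ∀ Q ∈ S, dist x P ≤ dist x Q}

/-- `F` is a facet of the three-dimensional closed convex set `C`: a face (the set where some
linear functional attains its maximum over `C`) of dimension two. -/
def IsFacet (C F : Set E3) : Prop :=
  F.Nonempty ∧ IsExposed ℝ C F ∧ Module.finrank ℝ (vectorSpan ℝ F) = 2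

/-- The orbit `GP` of a point under a group of isometries. -/
def orbitOf (G : Subgroup (E3 ≃ᵃⁱ[ℝ] E3)) (P : E3) : Set E3 :=
  {Q | ∃ g ∈ G, g P = Q}

/-- The Dirichlet stereohedron for `G` with base point `P`: the Voronoi region of `P` in the
Voronoi diagram of the orbit `GP`. -/
def dirichletStereohedron (G : Subgroup (E3 ≃ᵃⁱ[ℝ] E3)) (P : E3) : Set E3 :=
  voronoiRegion (orbitOf G P) P

/-- `Q` is a neighbour of `P` in the orbit `GP`: another orbit point whose Voronoi region shares
a facet with that of `P`. -/
def IsNeighbor (G : Subgroup (E3 ≃ᵃⁱ[ℝ] E3)) (P Q : E3) : Prop :=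
  Q ∈ orbitOf G P ∧ Q ≠ P ∧
    ∃ F, IsFacet (voronoiRegion (orbitOf G P) P) F ∧ IsFacet (voronoiRegion (orbitOf G P) Q) F

/-! ### The space group `R -3 2/c` (No. 167), in hexagonal coordinates -/

namespace R3c

/-- The order-three rotation `(x, y, z) ↦ (-y, x - y, z)`. -/
def rot3 : (Fin 3 → ℝ) ≃ₗ[ℝ] (Fin 3 → ℝ) where
  toFun p := ![-p 1, p 0 - p 1, p 2]
  invFun p := ![p 1 - p 0, -p 0, p 2]
  map_add' p q := by ext i; fin_cases i <;> simp <;> ring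
  map_smul' c p := by ext i; fin_cases i <;> simp; ring
  left_inv p := by ext i; fin_cases i <;> simp
  right_inv p := by ext i; fin_cases i <;> simp

/-- The linear part `(x, y, z) ↦ (y, x, -z)` of the horizontal order-two rotations. -/
def rot2 : (Fin 3 → ℝ) ≃ₗ[ℝ] (Fin 3 → ℝ) where
  toFun p := ![p 1, p 0, -p 2]
  invFun p := ![p 1, p 0, -p 2]
  map_add' p q := by ext i; fin_cases i <;> simp; ring
  map_smul' c p := by ext i; fin_cases i <;> simp
  left_inv p := by ext i; fin_cases i <;> simp
  right_inv p := by ext i; fin_cases i <;> simp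

/-- The translation by `v`. -/
def trans (v : Fin 3 → ℝ) : (Fin 3 → ℝ) ≃ᵃ[ℝ] (Fin 3 → ℝ) :=
  AffineEquiv.constVAdd ℝ (Fin 3 → ℝ) v

/-- The standard copy of `R -3 2/c` in hexagonal coordinates, given by its generators:
the translations of the rhombohedral lattice, the rotation `(x, y, z) ↦ (-y, x - y, z)`, the
rotation `(x, y, z) ↦ (y, x, -z + 1/2)` and the inversion `(x, y, z) ↦ (-x, -y, -z)`. -/
def standardGroup : Subgroup ((Fin 3 → ℝ) ≃ᵃ[ℝ] (Fin 3 → ℝ)) :=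
  Subgroup.closure
    {trans ![1, 0, 0], trans ![0, 1, 0], trans ![0, 0, 1], trans ![2 / 3, 1 / 3, 1 / 3],
      rot3.toAffineEquiv,
      rot2.toAffineEquiv.trans (trans ![0, 0, 1 / 2]),
      (LinearEquiv.neg ℝ : (Fin 3 → ℝ) ≃ₗ[ℝ] (Fin 3 → ℝ)).toAffineEquiv}

end R3c

/-- The group `G` of isometries of Euclidean 3-space is of type `R -3 2/c`: some affine change of
coordinates carries `G` onto the standard copy of that group. -/
def IsTypeR3c (G : Subgroup (E3 ≃ᵃⁱ[ℝ] E3)) : Prop :=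
  ∃ φ : E3 ≃ᵃ[ℝ] (Fin 3 → ℝ),
    {f | ∃ g ∈ G, (φ.symm.trans g.toAffineEquiv).trans φ = f} =
      (R3c.standardGroup : Set ((Fin 3 → ℝ) ≃ᵃ[ℝ] (Fin 3 → ℝ)))

end

/-! A relative interior point of a facet of the Voronoi region of `P` is equidistant from `P` and
exactly one other orbit point `Q`, and strictly farther from all the rest. It therefore suffices to
bound these strict neighbours; the argument gives 78.

In the coordinates `rhombCoord` the translation lattice is L = {(a, b, c) : 3 ∣ a + b - c}, and
every vertical line over an integer point is an axis of rotations of order three. Two consequences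
of strictness carry the count. - Translations: if Q and Q + 2t are both strict neighbours with t ≠ 0
in L, then they are P - t and P + t (`IsStrictNeighbor.eq_add_of_eq_add_two`). So a class modulo 2L
holds at most one neighbour, or two among the translates of P. As L has odd index in ℤ³, its eight
classes modulo 2L are the parities of the coordinates. - Rotations: seen from a threefold axis, P
and a neighbour that is not a rotated copy of P subtend an angle below 120°
(`IsStrictNeighbor.not_shades`). With the bounds coming from the shortest horizontal lattice vectors
this rules out whole parity classes, according to the positions of the two points in the unit
triangles.

The orbit consists of four cosets of the subgroup generated by L and the rotations. If P is on no
threefold axis, each of the three foreign cosets has 3 · 8 = 24 classes, of which at least 6 are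
excluded. In the own coset, translates give at most 2 · 5 and rotated copies at most 16 - 2. The
total is 10 + 14 + 3 · 18 = 78. If P is on an axis, rotations give nothing beyond translations, and
the bound is 2 · 7 + 3 · 8 = 38. -/

open scoped RealInnerProductSpace

/-! ### From facets to strict neighbours -/

/-- Some point is equidistant from `P` and the point `Q ∈ S` and strictly farther away from all
other points of `S`. -/
def StrictlyAdjacent (S : Set E3) (P Q : E3) : Prop :=
  Q ∈ S ∧ Q ≠ P ∧ ∃ w, dist w P = dist w Q ∧ ∀ R ∈ S, R ≠ P → R ≠ Q → dist w P < dist w R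

theorem dist_le_dist_iff_inner (x P Q : E3) :
    dist x P ≤ dist x Q ↔ ⟪Q - P, x⟫ ≤ (‖Q‖ ^ 2 - ‖P‖ ^ 2) / 2 := by
  rw [dist_eq_norm, dist_eq_norm, ← sq_le_sq₀ (norm_nonneg _) (norm_nonneg _),
    norm_sub_sq_real, norm_sub_sq_real, inner_sub_left, real_inner_comm, real_inner_comm x Q]
  constructor <;> intro h <;> linarith

theorem dist_eq_dist_iff_inner (x P Q : E3) :
    dist x P = dist x Q ↔ ⟪Q - P, x⟫ = (‖Q‖ ^ 2 - ‖P‖ ^ 2) / 2 := by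
  rw [le_antisymm_iff, dist_le_dist_iff_inner, dist_le_dist_iff_inner, inner_sub_left,
    inner_sub_left]
  constructor
  · rintro ⟨h1, h2⟩
    linarith
  · intro h
    constructor <;> linarith

theorem convex_voronoiRegion (S : Set E3) (P : E3) : Convex ℝ (voronoiRegion S P) := by
  have : voronoiRegion S P =
      ⋂ Q ∈ S, {x : E3 | ⟪Q - P, x⟫ ≤ (‖Q‖ ^ 2 - ‖P‖ ^ 2) / 2} := by
    ext x
    simp [voronoiRegion, dist_le_dist_iff_inner]
  rw [this]
  exact convex_iInter₂ fun Q _ => convex_halfSpace_le (innerₗ E3 (Q - P)).isLinear _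

/-- The centroid of a maximal affinely independent subset serves as a relative interior point: a
functional maximal there is constant on the subset, hence on its affine span. -/
theorem Convex.exists_forall_eq_of_le {F : Set E3} (hF : Convex ℝ F) (hne : F.Nonempty) :
    ∃ w ∈ F, ∀ (l : E3 →ₗ[ℝ] ℝ) (c : ℝ), (∀ x ∈ F, l x ≤ c) → l w = c → ∀ x ∈ F, l x = c := by
  obtain ⟨t, htF, hspan, hind⟩ := exists_affineIndependent ℝ E3 F
  have hfin : t.Finite := finite_set_of_fin_dim_affineIndependent ℝ hind
  lift t to Finset E3 using hfin
  have htne : t.Nonempty := by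
    rw [← Finset.coe_nonempty, ← affineSpan_nonempty ℝ, hspan, affineSpan_nonempty]
    exact hne
  have hcard : (0 : ℝ) < t.card := by exact_mod_cast htne.card_pos
  refine ⟨∑ v ∈ t, (t.card : ℝ)⁻¹ • v, hF.sum_mem (fun _ _ => by positivity) ?_
    (fun v hv => htF hv), ?_⟩
  · rw [Finset.sum_const, nsmul_eq_mul, mul_inv_cancel₀ hcard.ne']
  intro l c hle hw x hx
  have hzero : ∀ v ∈ t, l v = c := by
    have hsum : ∑ v ∈ t, (c - l v) = 0 := by
      simp only [map_sum, map_smul, smul_eq_mul] at hw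
      rw [← Finset.mul_sum] at hw
      rw [Finset.sum_sub_distrib, Finset.sum_const, nsmul_eq_mul, ← hw]
      field_simp
      simp
    intro v hv
    have := (Finset.sum_eq_zero_iff_of_nonneg
      (fun v hv => sub_nonneg.2 (hle v (htF hv)))).1 hsum v hv
    linarith
  have hx' : x ∈ affineSpan ℝ (t : Set E3) := hspan ▸ subset_affineSpan ℝ F hx
  refine affineSpan_induction hx' (fun v hv => hzero v hv) ?_
  intro a u v w hu hv hw
  simp [hu, hv, hw]

/-- A set all of whose bounded parts are finite. -/
def IsLocallyFinite (S : Set E3) : Prop :=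
  ∀ (x : E3) (r : ℝ), (S ∩ Metric.closedBall x r).Finite

theorem IsLocallyFinite.mem_interior_voronoiRegion {S : Set E3} (hS : IsLocallyFinite S) {P w : E3}
    (hw : ∀ R ∈ S, R ≠ P → dist w P < dist w R) : w ∈ interior (voronoiRegion S P) := by
  have hfin := hS w (dist w P + 1)
  have hopen : IsOpen (⋂ R ∈ (S ∩ Metric.closedBall w (dist w P + 1)) \ {P},
      {x : E3 | dist x P < dist x R}) :=
    (hfin.subset Set.sdiff_subset).isOpen_biInter fun R _ =>
      isOpen_lt (continuous_id.dist continuous_const) (continuous_id.dist continuous_const)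
  rw [mem_interior]
  refine ⟨_ ∩ Metric.ball w (1 / 2), ?_, hopen.inter Metric.isOpen_ball, ?_,
    Metric.mem_ball_self (by norm_num)⟩
  · rintro x ⟨hx, hxw⟩ R hR
    rw [Metric.mem_ball] at hxw
    by_cases hRP : R = P
    · rw [hRP]
    by_cases hRw : R ∈ Metric.closedBall w (dist w P + 1)
    · exact (Set.mem_iInter₂.1 hx R ⟨⟨hR, hRw⟩, hRP⟩).le
    · rw [Metric.mem_closedBall, dist_comm] at hRw
      have h1 := dist_triangle x w P
      have h2 := dist_triangle w x R
      rw [dist_comm w x] at h2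
      linarith
  · exact Set.mem_iInter₂.2 fun R hR => hw R hR.1.1 hR.2

theorem finrank_bisector {v : E3} (hv : v ≠ 0) :
    Module.finrank ℝ (Submodule.span ℝ {v})ᗮ = 2 := by
  have : Fact (Module.finrank ℝ E3 = 2 + 1) := ⟨by simp⟩
  exact Submodule.finrank_orthogonal_span_singleton hv

theorem vectorSpan_eq_of_isFacet {F : Set E3} (hdim : Module.finrank ℝ (vectorSpan ℝ F) = 2)
    {P Q : E3} (hQP : Q ≠ P) (hF : ∀ x ∈ F, dist x P = dist x Q) :
    vectorSpan ℝ F = (Submodule.span ℝ {Q - P})ᗮ := by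
  refine Submodule.eq_of_le_of_finrank_eq ?_
    (hdim.trans (finrank_bisector (sub_ne_zero.2 hQP)).symm)
  rw [vectorSpan_def, Submodule.span_le]
  rintro _ ⟨x, hx, y, hy, rfl⟩
  rw [SetLike.mem_coe, Submodule.mem_orthogonal_singleton_iff_inner_right]
  have h1 := (dist_eq_dist_iff_inner x P Q).1 (hF x hx)
  have h2 := (dist_eq_dist_iff_inner y P Q).1 (hF y hy)
  simp only [vsub_eq_sub]
  rw [inner_sub_right, h1, h2, sub_self]

/-- At a relative interior point `w` of `F`, any bisector through `w` contains all of `F`. Some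
bisector passes through `w`, since otherwise `w` is interior to the region and `F` is
three-dimensional. Only one does, since two would share the direction plane of `F` and the point
`w`. The last conjunct makes `Q` determine `F`. -/
theorem IsFacet.exists_strictlyAdjacent {S : Set E3} (hS : IsLocallyFinite S) {P : E3}
    {F : Set E3} (hF : IsFacet (voronoiRegion S P) F) :
    ∃ Q ∈ S, Q ≠ P ∧ (∃ w ∈ F, dist w P = dist w Q ∧
      ∀ R ∈ S, R ≠ P → R ≠ Q → dist w P < dist w R) ∧
      F = {x ∈ voronoiRegion S P | dist x P = dist x Q} := by
  obtain ⟨hne, hexp, hdim⟩ := hF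
  have hconv := hexp.convex (convex_voronoiRegion S P)
  obtain ⟨l, hl⟩ := hexp hne
  have hsub : F ⊆ voronoiRegion S P := by
    rw [hl]
    exact fun x hx => hx.1
  obtain ⟨w, hwF, hw⟩ := hconv.exists_forall_eq_of_le hne
  have hbis : ∀ R ∈ S, dist w P = dist w R → ∀ x ∈ F, dist x P = dist x R := by
    intro R hR hwR x hx
    rw [dist_eq_dist_iff_inner] at hwR ⊢
    refine hw (innerₗ E3 (R - P)) _ (fun y hy => ?_) hwR x hx
    exact (dist_le_dist_iff_inner y P R).1 (hsub hy R hR)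
  have hconst : ∀ x ∈ F, ∀ y ∈ F, l x = l y := by
    intro x hx y hy
    rw [hl] at hx hy
    exact le_antisymm (hy.2 x hx.1) (hx.2 y hy.1)
  obtain ⟨Q, hQS, hQP, hwQ⟩ : ∃ Q ∈ S, Q ≠ P ∧ dist w P = dist w Q := by
    by_contra hcon
    push Not at hcon
    have hint := hS.mem_interior_voronoiRegion (P := P) (w := w) fun R hR hRP =>
      lt_of_le_of_ne (hsub hwF R hR) (hcon R hR hRP)
    have hmax : IsLocalMax l w := by
      filter_upwards [mem_interior_iff_mem_nhds.1 hint] with y hy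
      have := hl ▸ hwF
      exact this.2 y hy
    -- A linear functional with a local maximum vanishes, so `F` would be the whole region.
    have hl0 : l = 0 := by
      have := hmax.fderiv_eq_zero
      rwa [ContinuousLinearMap.fderiv] at this
    have hFC : F = voronoiRegion S P := by
      rw [hl, hl0]
      simp
    have htop : affineSpan ℝ F = ⊤ := by
      refine affineSpan_eq_top_of_nonempty_interior ⟨w, ?_⟩
      rw [hconv.convexHull_eq, hFC]
      exact hint
    rw [AffineSubspace.vectorSpan_eq_top_of_affineSpan_eq_top ℝ E3 E3 htop, finrank_top] at hdim
    simp at hdim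
  have hvec := vectorSpan_eq_of_isFacet hdim hQP (hbis Q hQS hwQ)
  refine ⟨Q, hQS, hQP, ⟨w, hwF, hwQ, ?_⟩, ?_⟩
  · intro R hR hRP hRQ
    refine lt_of_le_of_ne (hsub hwF R hR) fun hwR => hRQ ?_
    have hvec' := vectorSpan_eq_of_isFacet hdim hRP (hbis R hR hwR)
    have hspan : Submodule.span ℝ {Q - P} = Submodule.span ℝ {R - P} := by
      rw [← Submodule.orthogonal_orthogonal (Submodule.span ℝ {Q - P}), ← hvec, hvec',
        Submodule.orthogonal_orthogonal]
    have hmem : R - P ∈ Submodule.span ℝ {Q - P} := by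
      rw [hspan]
      exact Submodule.mem_span_singleton_self _
    obtain ⟨c, hc⟩ := Submodule.mem_span_singleton.1 hmem
    have hc0 : c ≠ 0 := by
      rintro rfl
      rw [zero_smul] at hc
      exact hRP (sub_eq_zero.1 hc.symm)
    -- Applied to Q and to R with R - P = c(Q - P), this gives c = c², hence c = 1.
    have key : ∀ R : E3, dist w P = dist w R → 2 * ⟪R - P, w - P⟫ = ⟪R - P, R - P⟫ := by
      intro R h
      have e : w - R = (w - P) - (R - P) := by abel
      rw [dist_eq_norm, dist_eq_norm, e, ← sq_eq_sq₀ (norm_nonneg _) (norm_nonneg _),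
        norm_sub_sq_real (w - P)] at h
      rw [real_inner_self_eq_norm_sq, real_inner_comm]
      linarith
    have k1 := key Q hwQ
    have k2 := key R hwR
    rw [← hc, real_inner_smul_left, real_inner_smul_left, real_inner_smul_right] at k2
    have hpos : 0 < ⟪Q - P, Q - P⟫ := real_inner_self_pos.2 (sub_ne_zero.2 hQP)
    have hc1 : c = 1 := by
      have : c * ⟪Q - P, Q - P⟫ * (c - 1) = 0 := by linear_combination c * k1 - k2
      rcases mul_eq_zero.1 this with h | h
      · rcases mul_eq_zero.1 h with h | h
        · exact absurd h hc0
        · exact absurd h hpos.ne'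
      · linarith
    rw [hc1, one_smul] at hc
    exact (sub_left_inj.1 hc).symm
  · refine Set.Subset.antisymm (fun x hx => ⟨hsub hx, hbis Q hQS hwQ x hx⟩) ?_
    rintro x ⟨hx, hxQ⟩
    have hdir : x - w ∈ vectorSpan ℝ F := by
      rw [hvec, Submodule.mem_orthogonal_singleton_iff_inner_right, inner_sub_right,
        (dist_eq_dist_iff_inner x P Q).1 hxQ, (dist_eq_dist_iff_inner w P Q).1 hwQ, sub_self]
    have hker : vectorSpan ℝ F ≤ LinearMap.ker (l : E3 →ₗ[ℝ] ℝ) := by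
      rw [vectorSpan_def, Submodule.span_le]
      rintro _ ⟨a, ha, b, hb, rfl⟩
      simp [hconst a ha b hb]
    have hlx : l x = l w := by
      have := hker hdir
      rw [LinearMap.mem_ker] at this
      simpa [sub_eq_zero] using this
    have hwF' := hwF
    rw [hl] at hwF' ⊢
    exact ⟨hx, fun y hy => hlx ▸ hwF'.2 y hy⟩

theorem encard_facets_le {S : Set E3} (hS : IsLocallyFinite S) (P : E3) :
    {F | IsFacet (voronoiRegion S P) F}.encard ≤ {Q | StrictlyAdjacent S P Q}.encard := by
  have h : ∀ F ∈ {F | IsFacet (voronoiRegion S P) F}, ∃ Q, StrictlyAdjacent S P Q ∧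
      F = {x ∈ voronoiRegion S P | dist x P = dist x Q} := by
    intro F hF
    obtain ⟨Q, hQS, hQP, ⟨w, -, hw⟩, hFQ⟩ := IsFacet.exists_strictlyAdjacent hS hF
    exact ⟨Q, ⟨hQS, hQP, w, hw⟩, hFQ⟩
  choose! f hf using h
  refine Set.encard_le_encard_of_injOn (f := f) (fun F hF => (hf F hF).1) ?_
  intro F hF F' hF' e
  rw [(hf F hF).2, (hf F' hF').2, e]

/-- The shared facet has a point whose only nearest orbit points are `P` and some `Q'`; lying also
in the region of `Q`, it forces `Q' = Q`. -/
theorem strictlyAdjacent_of_isNeighbor {G : Subgroup (E3 ≃ᵃⁱ[ℝ] E3)} {P Q : E3}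
    (hS : IsLocallyFinite (orbitOf G P)) (hP : P ∈ orbitOf G P) (hQ : IsNeighbor G P Q) :
    StrictlyAdjacent (orbitOf G P) P Q := by
  obtain ⟨hQS, hQP, F, hF, hF'⟩ := hQ
  obtain ⟨Q', hQS', hQP', ⟨w, hwF, hw, hlt⟩, -⟩ := IsFacet.exists_strictlyAdjacent hS hF
  by_cases e : Q = Q'
  · subst e
    exact ⟨hQS, hQP, w, hw, hlt⟩
  · obtain ⟨l, hl⟩ := hF'.2.1 hF'.1
    rw [hl] at hwF
    exact absurd (hwF.1 P hP) (not_le.2 (hlt Q hQS hQP e))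

/-! ### Planar obstructions: parity classes excluded by shading -/

/-- The angle at `(i, j)` between `(x, y)` and `(u, v)` (hexagonal coordinates) is at least `120°`. -/
def Shades (i j x y u v : ℝ) : Prop :=
  ((x - i) - (y - j)) * (u - i) + (y - j) * (v - j) ≤ 0 ∧
    ((x - i) - (y - j)) * (u - i) + (y - j) * (v - j) ≤ (x - i) * (v - j) - (y - j) * (u - i)

/-- The planar conditions on the projections of a point and a strict neighbour of it. -/
structure Admissible (x y u v : ℝ) : Prop where
  fst : |u - x| < 2
  snd : |v - y| < 2
  sub : |(u - x) - (v - y)| < 2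
  not_shades : ∀ i j : ℤ, ¬ Shades i j x y u v

/-- For triangles of opposite orientation the odd-odd class is always excluded: the size bounds
leave only m, n = ±1, and in each case either a vertex of the first triangle shades the pair or a
size bound fails. -/
theorem not_admissible_down {x y u v : ℝ} (hy : 0 ≤ y) (hyx : y ≤ x) (hx : x ≤ 1)
    (hu : 0 ≤ u) (huv : u ≤ v) (hv : v ≤ 1) {m n : ℤ} (hm : Odd m) (hn : Odd n) :
    ¬ Admissible x y (u + m) (v + n) := by
  rintro ⟨h1, h2, h3, h4⟩
  rw [abs_lt] at h1 h2 h3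
  have hm1 : m < 3 := by have : (m : ℝ) < 3 := by linarith
                         exact_mod_cast this
  have hm2 : -3 < m := by have : (-3 : ℝ) < m := by linarith
                          exact_mod_cast this
  have hn1 : n < 3 := by have : (n : ℝ) < 3 := by linarith
                         exact_mod_cast this
  have hn2 : -3 < n := by have : (-3 : ℝ) < n := by linarith
                          exact_mod_cast this
  have key : ∃ i j : ℤ, Shades i j x y (u + m) (v + n) := by
    -- The shading inequalities are bilinear in the two points, so they become linear in the nine
    -- products of barycentric coordinates.
    have e1 := mul_nonneg hy hu
    have e2 := mul_nonneg hy (sub_nonneg.2 huv)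
    have e3 := mul_nonneg hy (sub_nonneg.2 hv)
    have e4 := mul_nonneg (sub_nonneg.2 hyx) hu
    have e5 := mul_nonneg (sub_nonneg.2 hyx) (sub_nonneg.2 huv)
    have e6 := mul_nonneg (sub_nonneg.2 hyx) (sub_nonneg.2 hv)
    have e7 := mul_nonneg (sub_nonneg.2 hx) hu
    have e8 := mul_nonneg (sub_nonneg.2 hx) (sub_nonneg.2 huv)
    have e9 := mul_nonneg (sub_nonneg.2 hx) (sub_nonneg.2 hv)
    have hm' : m = 1 ∨ m = -1 := by obtain ⟨k, rfl⟩ := hm; omega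
    have hn' : n = 1 ∨ n = -1 := by obtain ⟨k, rfl⟩ := hn; omega
    rcases hm' with rfl | rfl <;> rcases hn' with rfl | rfl
    · exact ⟨1, 1, by constructor <;> push_cast <;> nlinarith⟩
    · exact ⟨1, 0, by constructor <;> push_cast <;> nlinarith⟩
    -- Here (u - x) - (v - y) ≤ 2 - 2 · 2 in the shifted coordinates, against the third size bound.
    · exfalso; push_cast at h1 h2 h3; linarith
    · exact ⟨0, 0, by constructor <;> push_cast <;> nlinarith⟩
  obtain ⟨i, j, h⟩ := key
  exact h4 i j h

section Up

variable {x y u v : ℝ} (hy : 0 ≤ y) (hyx : y ≤ x) (hx : x ≤ 1) (hv : 0 ≤ v) (hvu : v ≤ u)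
  (hu : u ≤ 1)
include hy hyx hx hv hvu hu

theorem Admissible.int_bounds {m n : ℤ} (h : Admissible x y (u + m) (v + n)) :
    (-3 < m ∧ m < 3) ∧ (-3 < n ∧ n < 3) ∧ (-3 < m - n ∧ m - n < 3) := by
  obtain ⟨h1, h2, h3, -⟩ := h
  rw [abs_lt] at h1 h2 h3
  refine ⟨⟨?_, ?_⟩, ⟨?_, ?_⟩, ⟨?_, ?_⟩⟩ <;> rify <;> linarith

/-- For triangles of equal orientation a class is excluded only under a condition on barycentric
products, `h1` and `h2`. The size bounds leave four translates, and each is shaded from an explicit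
integer point. The next two lemmas treat the other two edge directions. -/
theorem Admissible.not_fst_class {m n : ℤ} (hm : Odd m) (hn : Even n)
    (h1 : y * v ≤ (1 - x) * (u - v)) (h2 : y * v ≤ (x - y) * (1 - u)) :
    ¬ Admissible x y (u + m) (v + n) := by
  intro h
  obtain ⟨b1, b2, b3⟩ := h.int_bounds hy hyx hx hv hvu hu
  have e1 := mul_nonneg hy hv
  have e2 := mul_nonneg hy (sub_nonneg.2 hvu)
  have e3 := mul_nonneg hy (sub_nonneg.2 hu)
  have e4 := mul_nonneg (sub_nonneg.2 hyx) hv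
  have e5 := mul_nonneg (sub_nonneg.2 hyx) (sub_nonneg.2 hvu)
  have e6 := mul_nonneg (sub_nonneg.2 hyx) (sub_nonneg.2 hu)
  have e7 := mul_nonneg (sub_nonneg.2 hx) hv
  have e8 := mul_nonneg (sub_nonneg.2 hx) (sub_nonneg.2 hvu)
  have e9 := mul_nonneg (sub_nonneg.2 hx) (sub_nonneg.2 hu)
  have hmn : (m = 1 ∧ n = 0) ∨ (m = -1 ∧ n = 0) ∨ (m = 1 ∧ n = 2) ∨ (m = -1 ∧ n = -2) := by
    obtain ⟨k, rfl⟩ := hm; obtain ⟨l, rfl⟩ := hn; omega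
  rcases hmn with ⟨rfl, rfl⟩ | ⟨rfl, rfl⟩ | ⟨rfl, rfl⟩ | ⟨rfl, rfl⟩
  · exact h.not_shades 1 0 (by constructor <;> push_cast <;> nlinarith)
  · exact h.not_shades 0 0 (by constructor <;> push_cast <;> nlinarith)
  · exact h.not_shades 1 1 (by constructor <;> push_cast <;> nlinarith)
  · exact h.not_shades 0 (-1) (by constructor <;> push_cast <;> nlinarith)

theorem Admissible.not_snd_class {m n : ℤ} (hm : Even m) (hn : Odd n)
    (h1 : (1 - x) * (1 - u) ≤ (x - y) * v) (h2 : (1 - x) * (1 - u) ≤ y * (u - v)) :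
    ¬ Admissible x y (u + m) (v + n) := by
  intro h
  obtain ⟨b1, b2, b3⟩ := h.int_bounds hy hyx hx hv hvu hu
  have e1 := mul_nonneg hy hv
  have e2 := mul_nonneg hy (sub_nonneg.2 hvu)
  have e3 := mul_nonneg hy (sub_nonneg.2 hu)
  have e4 := mul_nonneg (sub_nonneg.2 hyx) hv
  have e5 := mul_nonneg (sub_nonneg.2 hyx) (sub_nonneg.2 hvu)
  have e6 := mul_nonneg (sub_nonneg.2 hyx) (sub_nonneg.2 hu)
  have e7 := mul_nonneg (sub_nonneg.2 hx) hv
  have e8 := mul_nonneg (sub_nonneg.2 hx) (sub_nonneg.2 hvu)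
  have e9 := mul_nonneg (sub_nonneg.2 hx) (sub_nonneg.2 hu)
  have hmn : (m = 0 ∧ n = 1) ∨ (m = 0 ∧ n = -1) ∨ (m = 2 ∧ n = 1) ∨ (m = -2 ∧ n = -1) := by
    obtain ⟨k, rfl⟩ := hm; obtain ⟨l, rfl⟩ := hn; omega
  rcases hmn with ⟨rfl, rfl⟩ | ⟨rfl, rfl⟩ | ⟨rfl, rfl⟩ | ⟨rfl, rfl⟩
  · exact h.not_shades 1 1 (by constructor <;> push_cast <;> nlinarith)
  · exact h.not_shades 1 0 (by constructor <;> push_cast <;> nlinarith)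
  · exact h.not_shades 2 1 (by constructor <;> push_cast <;> nlinarith)
  · exact h.not_shades 0 0 (by constructor <;> push_cast <;> nlinarith)

theorem Admissible.not_sum_class {m n : ℤ} (hm : Odd m) (hn : Odd n)
    (h1 : (x - y) * (u - v) ≤ y * (1 - u)) (h2 : (x - y) * (u - v) ≤ (1 - x) * v) :
    ¬ Admissible x y (u + m) (v + n) := by
  intro h
  obtain ⟨b1, b2, b3⟩ := h.int_bounds hy hyx hx hv hvu hu
  have e1 := mul_nonneg hy hv
  have e2 := mul_nonneg hy (sub_nonneg.2 hvu)
  have e3 := mul_nonneg hy (sub_nonneg.2 hu)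
  have e4 := mul_nonneg (sub_nonneg.2 hyx) hv
  have e5 := mul_nonneg (sub_nonneg.2 hyx) (sub_nonneg.2 hvu)
  have e6 := mul_nonneg (sub_nonneg.2 hyx) (sub_nonneg.2 hu)
  have e7 := mul_nonneg (sub_nonneg.2 hx) hv
  have e8 := mul_nonneg (sub_nonneg.2 hx) (sub_nonneg.2 hvu)
  have e9 := mul_nonneg (sub_nonneg.2 hx) (sub_nonneg.2 hu)
  have hmn : (m = 1 ∧ n = 1) ∨ (m = -1 ∧ n = -1) ∨ (m = 1 ∧ n = -1) ∨ (m = -1 ∧ n = 1) := by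
    obtain ⟨k, rfl⟩ := hm; obtain ⟨l, rfl⟩ := hn; omega
  rcases hmn with ⟨rfl, rfl⟩ | ⟨rfl, rfl⟩ | ⟨rfl, rfl⟩ | ⟨rfl, rfl⟩
  · exact h.not_shades 1 1 (by constructor <;> push_cast <;> nlinarith)
  · exact h.not_shades 0 0 (by constructor <;> push_cast <;> nlinarith)
  · exact h.not_shades 1 0 (by constructor <;> push_cast <;> nlinarith)
  · exact h.not_shades 0 1 (by constructor <;> push_cast <;> nlinarith)

end Up

/-! ### Consequences of strictness for translations and rotations -/

/-- The squared distance in scaled hexagonal coordinates. -/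
def hexSqDist (s h : ℝ) (v w : ℝ × ℝ × ℝ) : ℝ :=
  s * ((v.1 - w.1) ^ 2 - (v.1 - w.1) * (v.2.1 - w.2.1) + (v.2.1 - w.2.1) ^ 2) +
    h * (v.2.2 - w.2.2) ^ 2

/-- The rotation of order three about the vertical coordinate axis. -/
def hexRot (v : ℝ × ℝ × ℝ) : ℝ × ℝ × ℝ := (-v.2.1, v.1 - v.2.1, v.2.2)

/-- The vector with the given integer coordinates. -/
def intVec (a b c : ℤ) : ℝ × ℝ × ℝ := (a, b, c)

/-- `Q` is a point of `O` such that some point is equidistant from `P` and `Q` and strictly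
farther away from all other points of `O`. -/
def IsStrictNeighbor (s h : ℝ) (O : Set (ℝ × ℝ × ℝ)) (P Q : ℝ × ℝ × ℝ) : Prop :=
  Q ∈ O ∧ Q ≠ P ∧ ∃ w, hexSqDist s h w P = hexSqDist s h w Q ∧
    ∀ R ∈ O, R ≠ P → R ≠ Q → hexSqDist s h w P < hexSqDist s h w R

/-- `O` is invariant under the rhombohedral lattice and the rotation of order three. -/
structure IsRhombohedral (O : Set (ℝ × ℝ × ℝ)) : Prop where
  add_mem : ∀ Q ∈ O, ∀ a b c : ℤ, 3 ∣ a + b - c → Q + intVec a b c ∈ O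
  rot_mem : ∀ Q ∈ O, hexRot Q ∈ O

theorem intVec_eq_zero_iff {a b c : ℤ} : intVec a b c = 0 ↔ a = 0 ∧ b = 0 ∧ c = 0 := by
  simp [intVec, Prod.ext_iff]

section Delone

variable {s h : ℝ} {O : Set (ℝ × ℝ × ℝ)} {P Q : ℝ × ℝ × ℝ}

/-- With t = (a, b, c), the witness is closer to P than to P + t and closer to Q than to Q - t;
adding the two inequalities eliminates it and leaves ⟨Q - P, t⟩ < ⟨t, t⟩. -/
theorem IsStrictNeighbor.inner_lt (hO : IsRhombohedral O) (hP : P ∈ O)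
    (hQ : IsStrictNeighbor s h O P Q) {a b c : ℤ} (hd : 3 ∣ a + b - c) (h0 : intVec a b c ≠ 0)
    (hne : P + intVec a b c ≠ Q) :
    s * ((Q.1 - P.1) * (2 * a - b) + (Q.2.1 - P.2.1) * (2 * b - a)) / 2 +
      h * ((Q.2.2 - P.2.2) * c) < s * (a ^ 2 - a * b + b ^ 2) + h * c ^ 2 := by
  obtain ⟨hQO, hQP, w, hw, hlt⟩ := hQ
  have h1 := hlt _ (hO.add_mem P hP a b c hd) (by simpa using h0) hne
  have hneg : intVec (-a) (-b) (-c) = -intVec a b c := by simp [intVec]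
  have h2 := hlt _ (hO.add_mem Q hQO (-a) (-b) (-c) (by omega))
    (by rw [hneg]; intro e; apply hne; rw [← e]; abel) (by rw [hneg]; simpa using h0)
  simp only [hexSqDist, intVec, Prod.fst_add, Prod.snd_add, Int.cast_neg] at h1 h2 hw
  linarith

/-- Otherwise `inner_lt` for Q' with t and for Q with -t add up to 2⟨t, t⟩ < 2⟨t, t⟩. -/
theorem IsStrictNeighbor.eq_add_of_eq_add_two (hO : IsRhombohedral O) (hP : P ∈ O)
    {Q' : ℝ × ℝ × ℝ} (hQ : IsStrictNeighbor s h O P Q) (hQ' : IsStrictNeighbor s h O P Q')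
    {a b c : ℤ} (hd : 3 ∣ a + b - c) (he : Q' = Q + intVec (2 * a) (2 * b) (2 * c))
    (hne : Q' ≠ Q) : Q' = P + intVec a b c := by
  have h0 : intVec a b c ≠ 0 := by
    intro e
    rw [intVec_eq_zero_iff] at e
    apply hne
    rw [he, e.1, e.2.1, e.2.2]
    simp [intVec]
  have hneg : intVec (-a) (-b) (-c) = -intVec a b c := by simp [intVec]
  have h2 : intVec (2 * a) (2 * b) (2 * c) = intVec a b c + intVec a b c := by
    simp [intVec, two_mul]
  by_contra hcon
  have i1 := hQ'.inner_lt hO hP hd h0 (fun e => hcon e.symm)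
  have i2 := hQ.inner_lt hO hP (a := -a) (b := -b) (c := -c) (by omega)
    (by rw [hneg]; simpa using h0) (by
      intro e
      apply hcon
      rw [he, ← e, hneg, h2]
      abel)
  subst he
  simp only [intVec, Prod.fst_add, Prod.snd_add] at i1 i2
  push_cast at i1 i2
  nlinarith

theorem IsStrictNeighbor.not_even (hs : 0 < s) (hh : 0 < h) (hO : IsRhombohedral O) (hP : P ∈ O)
    {a b c : ℤ} (hd : 3 ∣ a + b - c) :
    ¬ IsStrictNeighbor s h O P (P + intVec (2 * a) (2 * b) (2 * c)) := by
  intro hQ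
  have h2 : intVec (2 * a) (2 * b) (2 * c) = intVec a b c + intVec a b c := by
    simp [intVec, two_mul]
  have h0 : intVec a b c ≠ 0 := by
    intro e
    apply hQ.2.1
    rw [h2, e]
    simp
  have i1 := hQ.inner_lt hO hP hd h0 (by
    rw [h2]
    intro e
    exact h0 (by simpa using e))
  simp only [intVec, Prod.fst_add, Prod.snd_add] at i1
  push_cast at i1
  nlinarith [mul_nonneg hs.le (sq_nonneg ((a : ℝ) - b)), mul_nonneg hs.le (sq_nonneg (a : ℝ)),
    mul_nonneg hs.le (sq_nonneg (b : ℝ)), mul_nonneg hh.le (sq_nonneg (c : ℝ))]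

/-- The rotation of order three about the vertical axis through `(i, j)`. -/
def hexRotAt (i j : ℤ) (v : ℝ × ℝ × ℝ) : ℝ × ℝ × ℝ :=
  hexRot v + intVec (i + j) (2 * j - i) 0

theorem hexRotAt_mem (hO : IsRhombohedral O) (hQ : Q ∈ O) (i j : ℤ) : hexRotAt i j Q ∈ O :=
  hO.add_mem _ (hO.rot_mem Q hQ) _ _ _ (by omega)

theorem hexRotAt_three (i j : ℤ) (v : ℝ × ℝ × ℝ) :
    hexRotAt i j (hexRotAt i j (hexRotAt i j v)) = v := by
  simp only [hexRotAt, hexRot, intVec, Prod.ext_iff, Prod.fst_add, Prod.snd_add]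
  push_cast
  refine ⟨by ring, by ring, by ring⟩

theorem hexRotAt_ne {i j : ℤ} {v : ℝ × ℝ × ℝ} (hv : ¬ ∃ i j : ℤ, v.1 = i ∧ v.2.1 = j) :
    hexRotAt i j v ≠ v := by
  intro e
  simp only [hexRotAt, hexRot, intVec, Prod.ext_iff, Prod.fst_add, Prod.snd_add] at e
  push_cast at e
  exact hv ⟨i, j, by linarith [e.1, e.2.1], by linarith [e.1, e.2.1]⟩

/-- The witness is closer to P than to the two copies of P rotated about the axis, so seen from the
axis it makes an angle below 60° with P. The same holds for Q, so P and Q are less than 120° apart.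
The hypotheses keep all the rotated copies distinct from P and Q. -/
theorem IsStrictNeighbor.not_shades (hs : 0 < s) (hO : IsRhombohedral O) (hP : P ∈ O)
    (hQ : IsStrictNeighbor s h O P Q) (hPi : ¬ ∃ i j : ℤ, P.1 = i ∧ P.2.1 = j)
    (hQi : ¬ ∃ i j : ℤ, Q.1 = i ∧ Q.2.1 = j) {i j : ℤ} (h1 : hexRotAt i j P ≠ Q)
    (h2 : hexRotAt i j (hexRotAt i j P) ≠ Q) :
    ¬ Shades i j P.1 P.2.1 Q.1 Q.2.1 := by
  rintro ⟨z0, z1⟩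
  obtain ⟨hQO, hQP, w, hw, hlt⟩ := hQ
  have hP1 := hexRotAt_mem hO hP i j
  have hQ1 := hexRotAt_mem hO hQO i j
  have p1 := hlt _ hP1 (hexRotAt_ne hPi) h1
  have p2 := hlt _ (hexRotAt_mem hO hP1 i j) (fun e => hexRotAt_ne (i := i) (j := j) hPi (by
    have := congrArg (hexRotAt i j) e
    rw [hexRotAt_three] at this
    exact this.symm)) h2
  have q1 := hlt _ hQ1 (fun e => h2 (by rw [← e, hexRotAt_three])) (hexRotAt_ne hQi)
  have q2 := hlt _ (hexRotAt_mem hO hQ1 i j) (fun e => h1 (by rw [← e, hexRotAt_three]))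
    (fun e => hexRotAt_ne (i := i) (j := j) hQi (by
      have := congrArg (hexRotAt i j) e
      rw [hexRotAt_three] at this
      exact this.symm))
  rw [hw] at q1 q2
  have hpos : 0 < (P.1 - i) ^ 2 - (P.1 - i) * (P.2.1 - j) + (P.2.1 - j) ^ 2 := by
    by_contra hle
    have e2 : P.2.1 - j = 0 := by
      nlinarith [sq_nonneg (2 * (P.1 - i) - (P.2.1 - j)), sq_nonneg (P.2.1 - j)]
    have e1 : P.1 - i = 0 := by
      rw [e2] at hle
      nlinarith [sq_nonneg (P.1 - i)]
    exact hPi ⟨i, j, by linarith, by linarith⟩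
  obtain ⟨px, py, pz⟩ := P
  obtain ⟨qx, qy, qz⟩ := Q
  obtain ⟨wx, wy, wz⟩ := w
  simp only [hexSqDist, hexRotAt, hexRot, intVec, Prod.fst_add, Prod.snd_add] at *
  push_cast at *
  obtain ⟨a, rfl⟩ : ∃ a, px = a + i := ⟨px - i, by ring⟩
  obtain ⟨b, rfl⟩ : ∃ b, py = b + j := ⟨py - j, by ring⟩
  obtain ⟨u, rfl⟩ : ∃ u, qx = u + i := ⟨qx - i, by ring⟩
  obtain ⟨v, rfl⟩ : ∃ v, qy = v + j := ⟨qy - j, by ring⟩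
  obtain ⟨x, rfl⟩ : ∃ x, wx = x + i := ⟨wx - i, by ring⟩
  obtain ⟨y, rfl⟩ : ∃ y, wy = y + j := ⟨wy - j, by ring⟩
  simp only [add_sub_cancel_right] at z0 z1 hpos
  -- twice the inner products of `(x, y)` with `(a, b)` and its two rotated copies
  obtain ⟨s0, hs0⟩ : ∃ t, t = 2 * x * a + 2 * y * b - x * b - y * a := ⟨_, rfl⟩
  obtain ⟨s1, hs1⟩ : ∃ t, t = -2 * x * b + 2 * y * (a - b) - x * (a - b) + y * b := ⟨_, rfl⟩
  obtain ⟨s2, hs2⟩ : ∃ t, t = 2 * x * (b - a) - 2 * y * a + x * a - y * (b - a) := ⟨_, rfl⟩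
  have c1 : s1 < s0 := by
    have : 0 < s * (s0 - s1) := by rw [hs0, hs1]; linarith
    linarith [pos_of_mul_pos_right this hs.le]
  have c2 : s2 < s0 := by
    have : 0 < s * (s0 - s2) := by rw [hs0, hs2]; linarith
    linarith [pos_of_mul_pos_right this hs.le]
  obtain ⟨t0, ht0⟩ : ∃ t, t = 2 * x * u + 2 * y * v - x * v - y * u := ⟨_, rfl⟩
  obtain ⟨t1, ht1⟩ : ∃ t, t = -2 * x * v + 2 * y * (u - v) - x * (u - v) + y * v := ⟨_, rfl⟩
  obtain ⟨t2, ht2⟩ : ∃ t, t = 2 * x * (v - u) - 2 * y * u + x * u - y * (v - u) := ⟨_, rfl⟩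
  have d1 : t1 < t0 := by
    have : 0 < s * (t0 - t1) := by rw [ht0, ht1]; linarith
    linarith [pos_of_mul_pos_right this hs.le]
  have d2 : t2 < t0 := by
    have : 0 < s * (t0 - t2) := by rw [ht0, ht2]; linarith
    linarith [pos_of_mul_pos_right this hs.le]
  obtain ⟨n, hn⟩ : ∃ n, n = a ^ 2 - a * b + b ^ 2 := ⟨_, rfl⟩
  obtain ⟨α, hα⟩ : ∃ t, t = (a * v - b * u) - ((a - b) * u + b * v) := ⟨_, rfl⟩
  obtain ⟨β, hβ⟩ : ∃ t, t = -((a - b) * u + b * v) := ⟨_, rfl⟩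
  -- Shading means that Q lies in the cone spanned by the rotated copies of P, with coefficients α/n
  -- and β/n. Rotating this relation gives `f1` and `f2`.
  have f0 : n * t0 = α * s1 + β * s2 := by rw [hn, ht0, hα, hβ, hs1, hs2]; ring
  have f1 : n * t1 = α * s2 + β * s0 := by rw [hn, ht1, hα, hβ, hs0, hs2]; ring
  have f2 : n * t2 = α * s0 + β * s1 := by rw [hn, ht2, hα, hβ, hs1, hs0]; ring
  have hα0 : 0 ≤ α := by rw [hα]; linarith
  have hβ0 : 0 ≤ β := by rw [hβ]; linarith
  rw [← hn] at hpos
  have g1 := mul_lt_mul_of_pos_left d1 hpos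
  have g2 := mul_lt_mul_of_pos_left d2 hpos
  rw [f0, f1] at g1
  rw [f0, f2] at g2
  rcases le_total s1 s2 with hle | hle
  · linarith only [g1, mul_le_mul_of_nonneg_left hle hα0, mul_le_mul_of_nonneg_left c2.le hβ0]
  · linarith only [g2, mul_le_mul_of_nonneg_left hle hβ0, mul_le_mul_of_nonneg_left c1.le hα0]

/-- The size bounds are `inner_lt` for the six shortest horizontal lattice vectors t. The exception
Q = P + t does not occur, because P and P + t are shaded from an integer point. -/
theorem IsStrictNeighbor.admissible (hs : 0 < s) (hO : IsRhombohedral O) (hP : P ∈ O)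
    (hQ : IsStrictNeighbor s h O P Q) (hPi : ¬ ∃ i j : ℤ, P.1 = i ∧ P.2.1 = j)
    (hQi : ¬ ∃ i j : ℤ, Q.1 = i ∧ Q.2.1 = j) (hy : 0 ≤ P.2.1) (hyx : P.2.1 ≤ P.1)
    (hx : P.1 ≤ 1) (h1 : ∀ i j, hexRotAt i j P ≠ Q)
    (h2 : ∀ i j, hexRotAt i j (hexRotAt i j P) ≠ Q) :
    Admissible P.1 P.2.1 Q.1 Q.2.1 := by
  have hsh : ∀ i j : ℤ, ¬ Shades i j P.1 P.2.1 Q.1 Q.2.1 := fun i j =>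
    hQ.not_shades hs hO hP hPi hQi (h1 i j) (h2 i j)
  have key : ∀ a b i j : ℤ, 3 ∣ a + b → (a ≠ 0 ∨ b ≠ 0) →
      Shades i j P.1 P.2.1 (P.1 + a) (P.2.1 + b) →
      (Q.1 - P.1) * (2 * a - b) + (Q.2.1 - P.2.1) * (2 * b - a) <
        2 * (a ^ 2 - a * b + b ^ 2) := by
    intro a b i j hd h0 hab
    have := hQ.inner_lt hO hP (a := a) (b := b) (c := 0) (by omega)
      (by rw [Ne, intVec_eq_zero_iff]; omega)
      (by rintro rfl; exact hsh i j (by simpa [intVec] using hab))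
    push_cast at this
    by_contra hcon
    nlinarith [mul_le_mul_of_nonneg_left (not_lt.1 hcon) hs.le]
  have e1 := mul_nonneg hy hy
  have e2 := mul_nonneg hy (sub_nonneg.2 hyx)
  have e3 := mul_nonneg hy (sub_nonneg.2 hx)
  have e4 := mul_nonneg (sub_nonneg.2 hyx) (sub_nonneg.2 hyx)
  have e5 := mul_nonneg (sub_nonneg.2 hyx) (sub_nonneg.2 hx)
  have e6 := mul_nonneg (sub_nonneg.2 hx) (sub_nonneg.2 hx)
  have k1 := key 2 1 2 1 (by norm_num) (by norm_num) (by constructor <;> push_cast <;> nlinarith)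
  have k2 := key (-2) (-1) 0 0 (by norm_num) (by norm_num)
    (by constructor <;> push_cast <;> nlinarith)
  have k3 := key 1 2 1 1 (by norm_num) (by norm_num) (by constructor <;> push_cast <;> nlinarith)
  have k4 := key (-1) (-2) 0 (-1) (by norm_num) (by norm_num)
    (by constructor <;> push_cast <;> nlinarith)
  have k5 := key 1 (-1) 1 0 (by norm_num) (by norm_num)
    (by constructor <;> push_cast <;> nlinarith)
  have k6 := key (-1) 1 0 1 (by norm_num) (by norm_num)
    (by constructor <;> push_cast <;> nlinarith)
  push_cast at k1 k2 k3 k4 k5 k6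
  exact ⟨abs_lt.2 ⟨by linarith, by linarith⟩, abs_lt.2 ⟨by linarith, by linarith⟩,
    abs_lt.2 ⟨by linarith, by linarith⟩, hsh⟩

end Delone

/-! ### Counting by parity classes -/

/-- Residues modulo two of integer coordinates. -/
abbrev Parity : Type := ZMod 2 × ZMod 2 × ZMod 2

/-- The residues modulo two of an integer vector. -/
def parity (a b c : ℤ) : Parity := (a, b, c)

/-- Half of the difference stays in the lattice because 2 is invertible modulo 3. -/
theorem exists_eq_add_two_of_parity_eq {a b c a' b' c' : ℤ} (hd : 3 ∣ a + b - c)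
    (hd' : 3 ∣ a' + b' - c') (e : parity a b c = parity a' b' c') :
    ∃ k l m : ℤ, 3 ∣ k + l - m ∧ a' = a + 2 * k ∧ b' = b + 2 * l ∧ c' = c + 2 * m := by
  simp only [parity, Prod.mk.injEq] at e
  have h : ∀ x y : ℤ, (x : ZMod 2) = y → ∃ k, y = x + 2 * k := by
    intro x y hxy
    obtain ⟨k, hk⟩ := (ZMod.intCast_eq_intCast_iff_dvd_sub x y 2).1 hxy
    exact ⟨k, by push_cast at hk; omega⟩
  obtain ⟨k, hk⟩ := h _ _ e.1
  obtain ⟨l, hl⟩ := h _ _ e.2.1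
  obtain ⟨m, hm⟩ := h _ _ e.2.2
  exact ⟨k, l, m, by omega, hk, hl, hm⟩

theorem intVec_add (a b c a' b' c' : ℤ) :
    intVec a b c + intVec a' b' c' = intVec (a + a') (b + b') (c + c') := by
  simp [intVec]

section Counting

variable {s h : ℝ} {O : Set (ℝ × ℝ × ℝ)} {P : ℝ × ℝ × ℝ}

theorem encard_le_of_parity {ι : Type*} (hO : IsRhombohedral O) (hP : P ∈ O)
    {M : Set (ℝ × ℝ × ℝ)} (hM : ∀ Q ∈ M, IsStrictNeighbor s h O P Q)
    (hnot : ∀ Q ∈ M, ∀ a b c : ℤ, 3 ∣ a + b - c → Q ≠ P + intVec a b c) (B : ι → ℝ × ℝ × ℝ)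
    (good : Finset (ι × Parity))
    (hB : ∀ Q ∈ M, ∃ i, ∃ a b c : ℤ, 3 ∣ a + b - c ∧ Q = B i + intVec a b c ∧
      (i, parity a b c) ∈ good) : M.encard ≤ good.card := by
  obtain rfl | ⟨Q₀, hQ₀⟩ := M.eq_empty_or_nonempty
  · simp
  have : Nonempty ι := ⟨(hB Q₀ hQ₀).choose⟩
  choose! i a b c hB using hB
  rw [← Set.encard_coe_eq_coe_finsetCard]
  refine Set.encard_le_encard_of_injOn (f := fun Q => (i Q, parity (a Q) (b Q) (c Q)))
    (fun Q hQ => (hB Q hQ).2.2) ?_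
  intro Q hQ Q' hQ' e
  rw [Prod.mk.injEq] at e
  obtain ⟨hd, hq, -⟩ := hB Q hQ
  obtain ⟨hd', hq', -⟩ := hB Q' hQ'
  obtain ⟨k, l, m, hklm, ha, hb, hc⟩ := exists_eq_add_two_of_parity_eq hd hd' e.2
  by_contra hne
  refine hnot Q' hQ' k l m hklm ((hM Q hQ).eq_add_of_eq_add_two hO hP (hM Q' hQ') hklm ?_
    (Ne.symm hne))
  rw [hq, hq', ← e.1, ha, hb, hc, ← intVec_add, add_assoc]

theorem encard_translates_le (hO : IsRhombohedral O) (hP : P ∈ O)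
    (good : Finset Parity)
    (hgood : ∀ a b c : ℤ, 3 ∣ a + b - c → IsStrictNeighbor s h O P (P + intVec a b c) →
      parity a b c ∈ good) :
    {Q | IsStrictNeighbor s h O P Q ∧
      ∃ a b c : ℤ, 3 ∣ a + b - c ∧ Q = P + intVec a b c}.encard ≤ 2 * good.card := by
  have hcard : ((good ×ˢ (Finset.univ : Finset Bool)).card : ℕ∞) = 2 * good.card := by
    rw [Finset.card_product, Finset.card_univ, Fintype.card_bool, mul_comm]
    push_cast
    rfl
  rw [← hcard, ← Set.encard_coe_eq_coe_finsetCard]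
  set M := {Q | IsStrictNeighbor s h O P Q ∧ ∃ a b c : ℤ, 3 ∣ a + b - c ∧ Q = P + intVec a b c}
  have hM : ∀ Q ∈ M, ∃ a b c : ℤ, 3 ∣ a + b - c ∧ Q = P + intVec a b c := fun Q hQ => hQ.2
  choose! a b c hM using hM
  -- Two neighbours in one class are opposite translates P ± t, which the lexicographic sign of t
  -- tells apart.
  refine Set.encard_le_encard_of_injOn (f := fun Q => (parity (a Q) (b Q) (c Q),
    decide (0 < a Q ∨ a Q = 0 ∧ (0 < b Q ∨ b Q = 0 ∧ 0 < c Q)))) ?_ ?_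
  · intro Q hQ
    exact Finset.mem_coe.2 (Finset.mem_product.2
      ⟨hgood _ _ _ (hM Q hQ).1 ((hM Q hQ).2 ▸ hQ.1), Finset.mem_univ _⟩)
  intro Q hQ Q' hQ' e
  rw [Prod.mk.injEq] at e
  obtain ⟨hd, hq⟩ := hM Q hQ
  obtain ⟨hd', hq'⟩ := hM Q' hQ'
  obtain ⟨k, l, m, hklm, ha, hb, hc⟩ := exists_eq_add_two_of_parity_eq hd hd' e.1
  by_contra hne
  have he := hQ.1.eq_add_of_eq_add_two hO hP hQ'.1 hklm
    (by rw [hq, hq', ha, hb, hc, ← intVec_add, add_assoc]) (Ne.symm hne)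
  have h0 : ¬ (a Q = 0 ∧ b Q = 0 ∧ c Q = 0) := by
    rw [← intVec_eq_zero_iff]
    intro e0
    exact hQ.1.2.1 (by rw [hq, e0, add_zero])
  rw [hq', add_right_inj] at he
  simp only [intVec, Prod.mk.injEq, Int.cast_inj] at he
  have hsign := e.2
  rw [decide_eq_decide] at hsign
  omega

end Counting

/-! ### Triangles, barycentric coordinates and coset representatives -/

/-- The point projects into the triangle with vertices `(0, 0)`, `(1, 0)`, `(1, 1)`. -/
structure InUpTriangle (v : ℝ × ℝ × ℝ) : Prop where
  nonneg : 0 ≤ v.2.1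
  le : v.2.1 ≤ v.1
  le_one : v.1 ≤ 1

/-- The point projects into the triangle with vertices `(0, 0)`, `(0, 1)`, `(1, 1)`. -/
structure InDownTriangle (v : ℝ × ℝ × ℝ) : Prop where
  nonneg : 0 ≤ v.1
  le : v.1 ≤ v.2.1
  le_one : v.2.1 ≤ 1

/-- Barycentric coordinates with respect to `(0, 0)`, `(1, 0)`, `(1, 1)`. -/
def barycentric (v : ℝ × ℝ × ℝ) : Fin 3 → ℝ := ![1 - v.1, v.1 - v.2.1, v.2.1]

/-- The residue modulo two of the edge opposite to a vertex of the triangle `(0, 0)`, `(1, 0)`,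
`(1, 1)`. -/
def edgeClass : Fin 3 → ZMod 2 × ZMod 2 := ![(0, 1), (1, 1), (1, 0)]

/-- `Q` is the image of `S` under a rotation of order three and a lattice translation. -/
def InCoset (S Q : ℝ × ℝ × ℝ) : Prop :=
  ∃ κ : Fin 3, ∃ a b c : ℤ, 3 ∣ a + b - c ∧ Q = hexRot^[κ] S + intVec a b c

/-- The images of `B` under the powers of a screw rotation about the centre of the triangle
`(0, 0)`, `(1, 0)`, `(1, 1)`, up to vertical translations. -/
def upBase (B : ℝ × ℝ × ℝ) : Fin 3 → ℝ × ℝ × ℝ :=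
  ![B, hexRot B + intVec 1 0 4, hexRot (hexRot B) + intVec 1 1 2]

/-- The images of `B` under the powers of a screw rotation about the centre of the triangle
`(0, 0)`, `(0, 1)`, `(1, 1)`, up to vertical translations. -/
def downBase (B : ℝ × ℝ × ℝ) : Fin 3 → ℝ × ℝ × ℝ :=
  ![B, hexRot B + intVec 1 1 2, hexRot (hexRot B) + intVec 0 1 4]

theorem even_iff_cast_zmod_two {m : ℤ} : Even m ↔ (m : ZMod 2) = 0 :=
  ZMod.intCast_eq_zero_iff_even.symm

theorem odd_iff_cast_zmod_two {m : ℤ} : Odd m ↔ (m : ZMod 2) = 1 :=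
  ZMod.intCast_eq_one_iff_odd.symm

theorem not_admissible_of_edgeClass {v w : ℝ × ℝ × ℝ} (hv : InUpTriangle v) (hw : InUpTriangle w)
    {j : Fin 3} (h1 : barycentric v j * barycentric w j ≤
      barycentric v (j + 1) * barycentric w (j + 2))
    (h2 : barycentric v j * barycentric w j ≤ barycentric v (j + 2) * barycentric w (j + 1))
    {m n : ℤ} (hmn : ((m : ZMod 2), (n : ZMod 2)) = edgeClass j) :
    ¬ Admissible v.1 v.2.1 (w.1 + m) (w.2.1 + n) := by
  fin_cases j <;> simp [barycentric, edgeClass] at h1 h2 hmn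
  · exact Admissible.not_snd_class hv.nonneg hv.le hv.le_one hw.nonneg hw.le hw.le_one
      (even_iff_cast_zmod_two.2 hmn.1) (odd_iff_cast_zmod_two.2 hmn.2) h1 h2
  · exact Admissible.not_sum_class hv.nonneg hv.le hv.le_one hw.nonneg hw.le hw.le_one
      (odd_iff_cast_zmod_two.2 hmn.1) (odd_iff_cast_zmod_two.2 hmn.2) h1 h2
  · exact Admissible.not_fst_class hv.nonneg hv.le hv.le_one hw.nonneg hw.le hw.le_one
      (odd_iff_cast_zmod_two.2 hmn.1) (even_iff_cast_zmod_two.2 hmn.2) h1 h2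

theorem InUpTriangle.upBase {B : ℝ × ℝ × ℝ} (hB : InUpTriangle B) (κ : Fin 3) :
    InUpTriangle (upBase B κ) := by
  obtain ⟨h1, h2, h3⟩ := hB
  fin_cases κ <;> constructor <;> simp [_root_.upBase, hexRot, intVec] <;> linarith

/-- Rotating about the centre of the triangle permutes its vertices cyclically. -/
theorem barycentric_upBase (B : ℝ × ℝ × ℝ) (κ j : Fin 3) :
    barycentric (upBase B κ) j = barycentric B (j - κ) := by
  fin_cases κ <;> fin_cases j <;> simp [upBase, hexRot, intVec, barycentric] <;> ring

theorem InDownTriangle.downBase {B : ℝ × ℝ × ℝ} (hB : InDownTriangle B) (κ : Fin 3) :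
    InDownTriangle (downBase B κ) := by
  obtain ⟨h1, h2, h3⟩ := hB
  fin_cases κ <;> constructor <;> simp [_root_.downBase, hexRot, intVec] <;> linarith

theorem InCoset.exists_upBase {S Q B : ℝ × ℝ × ℝ} (hQ : InCoset S Q) {k l m : ℤ}
    (hd : 3 ∣ k + l - m) (hB : B = S + intVec k l m) :
    ∃ κ : Fin 3, ∃ a b c : ℤ, 3 ∣ a + b - c ∧ Q = upBase B κ + intVec a b c := by
  obtain ⟨κ, a, b, c, hd', rfl⟩ := hQ
  obtain ⟨x, y, z⟩ := S
  subst hB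
  refine ⟨κ, ?_⟩
  fin_cases κ
  · refine ⟨a - k, b - l, c - m, by omega, ?_⟩
    simp [upBase, intVec]
  · refine ⟨a + l - 1, b - k + l, c - m - 4, by omega, ?_⟩
    simp [upBase, intVec, hexRot]
    refine ⟨by ring, by ring⟩
  · refine ⟨a + k - l - 1, b + k - 1, c - m - 2, by omega, ?_⟩
    simp [upBase, intVec, hexRot]
    refine ⟨by ring, by ring⟩

theorem InCoset.exists_downBase {S Q B : ℝ × ℝ × ℝ} (hQ : InCoset S Q) {k l m : ℤ}
    (hd : 3 ∣ k + l - m) (hB : B = S + intVec k l m) :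
    ∃ κ : Fin 3, ∃ a b c : ℤ, 3 ∣ a + b - c ∧ Q = downBase B κ + intVec a b c := by
  obtain ⟨κ, a, b, c, hd', rfl⟩ := hQ
  obtain ⟨x, y, z⟩ := S
  subst hB
  refine ⟨κ, ?_⟩
  fin_cases κ
  · refine ⟨a - k, b - l, c - m, by omega, ?_⟩
    simp [downBase, intVec]
  · refine ⟨a + l - 1, b - k + l - 1, c - m - 2, by omega, ?_⟩
    simp [downBase, intVec, hexRot]
    refine ⟨by ring, by ring⟩
  · refine ⟨a + k - l, b + k - 1, c - m - 4, by omega, ?_⟩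
    simp [downBase, intVec, hexRot]
    refine ⟨by ring, by ring⟩

/-- A point on an integer axis differs from its rotated copies by horizontal lattice vectors. -/
theorem InCoset.exists_add_intVec {S Q : ℝ × ℝ × ℝ} (hQ : InCoset S Q)
    (hS : ∃ i j : ℤ, S.1 = i ∧ S.2.1 = j) :
    ∃ a b c : ℤ, 3 ∣ a + b - c ∧ Q = S + intVec a b c := by
  obtain ⟨κ, a, b, c, hd', rfl⟩ := hQ
  obtain ⟨x, y, z⟩ := S
  obtain ⟨i, j, hi, hj⟩ := hS
  simp only at hi hj
  subst hi hj
  fin_cases κ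
  · exact ⟨a, b, c, hd', rfl⟩
  · refine ⟨a - i - j, b + i - 2 * j, c, by omega, ?_⟩
    simp [intVec, hexRot]
    refine ⟨by ring, by ring⟩
  · refine ⟨a + j - 2 * i, b - i - j, c, by omega, ?_⟩
    simp [intVec, hexRot]
    refine ⟨by ring, by ring⟩

theorem exists_intVec_inTriangle (S : ℝ × ℝ × ℝ) : ∃ a b c : ℤ, 3 ∣ a + b - c ∧
    (InUpTriangle (S + intVec a b c) ∨ InDownTriangle (S + intVec a b c)) := by
  refine ⟨-⌊S.1⌋, -⌊S.2.1⌋, -⌊S.1⌋ - ⌊S.2.1⌋, by omega, ?_⟩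
  have h1 := Int.floor_le S.1
  have h2 := Int.lt_floor_add_one S.1
  have h3 := Int.floor_le S.2.1
  have h4 := Int.lt_floor_add_one S.2.1
  rcases le_total (S.2.1 - ⌊S.2.1⌋) (S.1 - ⌊S.1⌋) with h | h
  · left
    constructor <;> simp [intVec] <;> linarith
  · right
    constructor <;> simp [intVec] <;> linarith

/-- The nine products p j * q i split into three groups by c = i + j modulo 3, and the inequalities
for (κ, j) compare products within the group c = 2j - κ. The least product of each group excludes
one pair (κ, edge class) with either vertical parity, so 3 · 2 of the 24 labels go. -/
theorem exists_good_labels (p q : Fin 3 → ℝ) : ∃ good : Finset (Fin 3 × Parity),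
    good.card ≤ 18 ∧ ∀ κ x y z, (κ, x, y, z) ∉ good → ∃ j, (x, y) = edgeClass j ∧
      p j * q (j - κ) ≤ p (j + 1) * q (j + 2 - κ) ∧
      p j * q (j - κ) ≤ p (j + 2) * q (j + 1 - κ) := by
  have hJ : ∀ c : Fin 3, ∃ j, ∀ i, p j * q (c - j) ≤ p i * q (c - i) := fun c =>
    Finite.exists_min fun j => p j * q (c - j)
  choose J hJ using hJ
  let g : Fin 3 × ZMod 2 → Fin 3 × Parity := fun x =>
    (2 * J x.1 - x.1, (edgeClass (J x.1)).1, (edgeClass (J x.1)).2, x.2)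
  have hg : Function.Injective g := by
    rintro ⟨c, z⟩ ⟨c', z'⟩ e
    simp only [g, Prod.mk.injEq] at e
    obtain ⟨e1, e2, e3, rfl⟩ := e
    have hinj : ∀ i j : Fin 3, (edgeClass i).1 = (edgeClass j).1 →
        (edgeClass i).2 = (edgeClass j).2 → i = j := by decide
    have e4 := hinj _ _ e2 e3
    rw [e4] at e1
    have hsub : ∀ i c c' : Fin 3, 2 * i - c = 2 * i - c' → c = c' := by decide
    rw [hsub _ _ _ e1]
  refine ⟨Finset.univ \ Finset.univ.image g, ?_, ?_⟩
  · rw [Finset.card_sdiff_of_subset (Finset.subset_univ _), Finset.card_image_of_injective _ hg]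
    simp [Fintype.card_prod]
  · intro κ x y z hx
    simp only [Finset.mem_sdiff, Finset.mem_univ, true_and, not_not, Finset.mem_image] at hx
    obtain ⟨⟨c, z'⟩, hc⟩ := hx
    simp only [g, Prod.mk.injEq] at hc
    obtain ⟨rfl, rfl, rfl, rfl⟩ := hc
    have a0 : ∀ j c : Fin 3, j - (2 * j - c) = c - j := by decide
    have a1 : ∀ j c : Fin 3, j + 2 - (2 * j - c) = c - (j + 1) := by decide
    have a2 : ∀ j c : Fin 3, j + 1 - (2 * j - c) = c - (j + 2) := by decide
    refine ⟨J c, rfl, ?_, ?_⟩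
    · rw [a0, a1]
      exact hJ c _
    · rw [a0, a2]
      exact hJ c _

/-- When both points have the same barycentric coordinates up to rotation, every κ has an excluded
edge: at the least coordinate for κ = 0, and for κ = 1, 2 at the index where one inequality is an
equality and the other compares with the square of the largest coordinate. -/
theorem exists_own_edge (p : Fin 3 → ℝ) (hp : ∀ j, 0 ≤ p j) (κ : Fin 3) : ∃ j,
    p j * p (j - κ) ≤ p (j + 1) * p (j + 2 - κ) ∧
      p j * p (j - κ) ≤ p (j + 2) * p (j + 1 - κ) := by
  obtain ⟨a, ha⟩ := Finite.exists_min p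
  obtain ⟨b, hb⟩ := Finite.exists_max p
  have h1 : ∀ b : Fin 3, b + 2 + 1 = b ∧ b + 2 - 1 = b + 1 ∧ b + 2 + 2 = b + 1 ∧
      b + 2 + 1 - 1 = b + 2 ∧ b + 2 + 2 - 1 = b := by decide
  have h2 : ∀ b : Fin 3, b + 1 - 2 = b + 2 ∧ b + 1 + 1 = b + 2 ∧ b + 1 + 2 - 2 = b + 1 ∧
      b + 1 + 2 = b ∧ b + 1 + 1 - 2 = b := by decide
  have hκ : κ = 0 ∨ κ = 1 ∨ κ = 2 := by fin_cases κ <;> simp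
  rcases hκ with rfl | rfl | rfl
  · simp only [sub_zero]
    exact ⟨a, mul_le_mul (ha _) (ha _) (hp _) (hp _), mul_le_mul (ha _) (ha _) (hp _) (hp _)⟩
  · obtain ⟨e1, e2, e3, e4, e5⟩ := h1 b
    refine ⟨b + 2, ?_, ?_⟩
    · rw [e1, e2, e5]
      exact mul_le_mul (hb _) (hb _) (hp _) (hp _)
    · rw [e2, e3, e4, mul_comm]
  · obtain ⟨e1, e2, e3, e4, e5⟩ := h2 b
    refine ⟨b + 1, ?_, ?_⟩
    · rw [e1, e2, e3, mul_comm]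
    · rw [e1, e4, e5]
      exact mul_le_mul (hb _) (hb _) (hp _) (hp _)

/-! ### The bounds coset by coset -/

section Count

variable {s h : ℝ} {O : Set (ℝ × ℝ × ℝ)} {P : ℝ × ℝ × ℝ}

theorem hexRotAt_inCoset (i j : ℤ) (P : ℝ × ℝ × ℝ) : InCoset P (hexRotAt i j P) :=
  ⟨1, i + j, 2 * j - i, 0, by omega, by simp [hexRotAt]⟩

theorem hexRotAt_hexRotAt_inCoset (i j : ℤ) (P : ℝ × ℝ × ℝ) :
    InCoset P (hexRotAt i j (hexRotAt i j P)) := by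
  refine ⟨2, 2 * i - j, i + j, 0, by omega, ?_⟩
  simp [hexRotAt, hexRot, intVec]
  constructor <;> ring

theorem hexRotAt_snd_snd (i j : ℤ) (P : ℝ × ℝ × ℝ) : (hexRotAt i j P).2.2 = P.2.2 := by
  simp [hexRotAt, hexRot, intVec]

theorem inCoset_add_intVec (P : ℝ × ℝ × ℝ) {a b c : ℤ} (hd : 3 ∣ a + b - c) :
    InCoset P (P + intVec a b c) :=
  ⟨0, a, b, c, hd, rfl⟩

/-- If `S` can be moved into an up triangle, `exists_good_labels` excludes six labels; if into a
down triangle, the odd-odd class excludes two labels for each of the three rotations. -/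
theorem encard_other_coset_le (hs : 0 < s) (hO : IsRhombohedral O) (hP : P ∈ O)
    (hup : InUpTriangle P) (hni : ∀ Q ∈ O, ¬ ∃ i j : ℤ, Q.1 = i ∧ Q.2.1 = j)
    (S : ℝ × ℝ × ℝ) :
    {Q | IsStrictNeighbor s h O P Q ∧ ¬ InCoset P Q ∧ InCoset S Q}.encard ≤ 18 := by
  have hadm : ∀ Q, IsStrictNeighbor s h O P Q → ¬ InCoset P Q →
      Admissible P.1 P.2.1 Q.1 Q.2.1 := fun Q hQ hQP =>
    hQ.admissible hs hO hP (hni P hP) (hni Q hQ.1) hup.nonneg hup.le hup.le_one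
      (fun i j e => hQP (e ▸ hexRotAt_inCoset i j P))
      (fun i j e => hQP (e ▸ hexRotAt_hexRotAt_inCoset i j P))
  obtain ⟨k, l, m, hd, hB | hB⟩ := exists_intVec_inTriangle S
  · obtain ⟨good, hcard, hgood⟩ :=
      exists_good_labels (barycentric P) (barycentric (S + intVec k l m))
    refine (encard_le_of_parity (s := s) (h := h) hO hP (fun Q hQ => hQ.1)
      (fun Q hQ a b c hd e => hQ.2.1 (e ▸ inCoset_add_intVec P hd))
      (upBase (S + intVec k l m)) good ?_).trans (by exact_mod_cast hcard)
    rintro Q ⟨hQ, hQP, hQS⟩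
    obtain ⟨κ, a, b, c, hd', he⟩ := hQS.exists_upBase hd rfl
    refine ⟨κ, a, b, c, hd', he, ?_⟩
    by_contra hbad
    obtain ⟨j, hj, h1, h2⟩ := hgood _ _ _ _ hbad
    refine not_admissible_of_edgeClass hup (hB.upBase κ) (j := j) (m := a) (n := b) ?_ ?_ hj ?_
    · rwa [barycentric_upBase, barycentric_upBase]
    · rwa [barycentric_upBase, barycentric_upBase]
    · have := hadm Q hQ hQP
      rw [he] at this
      exact this
  · refine (encard_le_of_parity (s := s) (h := h) hO hP (fun Q hQ => hQ.1)
      (fun Q hQ a b c hd e => hQ.2.1 (e ▸ inCoset_add_intVec P hd))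
      (downBase (S + intVec k l m))
      (Finset.univ.filter fun x => ¬ (x.2.1 = 1 ∧ x.2.2.1 = 1)) ?_).trans
      (by exact_mod_cast (by decide +kernel :
        (Finset.univ.filter fun x : Fin 3 × Parity =>
          ¬ (x.2.1 = 1 ∧ x.2.2.1 = 1)).card ≤ 18))
    rintro Q ⟨hQ, hQP, hQS⟩
    obtain ⟨κ, a, b, c, hd', he⟩ := hQS.exists_downBase hd rfl
    refine ⟨κ, a, b, c, hd', he, ?_⟩
    simp only [Finset.mem_filter, Finset.mem_univ, true_and, parity]
    rintro ⟨ha, hb⟩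
    have hB' := hB.downBase κ
    refine not_admissible_down hup.nonneg hup.le hup.le_one hB'.nonneg hB'.le hB'.le_one
      (odd_iff_cast_zmod_two.2 ha) (odd_iff_cast_zmod_two.2 hb) ?_
    have := hadm Q hQ hQP
    rw [he] at this
    exact this

theorem encard_translates_le_ten (hs : 0 < s) (hh : 0 < h) (hO : IsRhombohedral O) (hP : P ∈ O)
    (hup : InUpTriangle P) (hni : ∀ Q ∈ O, ¬ ∃ i j : ℤ, Q.1 = i ∧ Q.2.1 = j) :
    {Q | IsStrictNeighbor s h O P Q ∧
      ∃ a b c : ℤ, 3 ∣ a + b - c ∧ Q = P + intVec a b c}.encard ≤ 10 := by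
  have hnn : ∀ j, 0 ≤ barycentric P j := by
    intro j
    have := hup.nonneg
    have := hup.le
    have := hup.le_one
    fin_cases j <;> simp [barycentric] <;> linarith
  obtain ⟨j, h1, h2⟩ := exists_own_edge (barycentric P) hnn 0
  simp only [sub_zero] at h1 h2
  -- Of eight classes, the zero class and the two over the excluded edge are lost.
  have hcard : ∀ j : Fin 3, (Finset.univ.filter fun x : Parity =>
      x ≠ 0 ∧ (x.1, x.2.1) ≠ edgeClass j).card = 5 := by decide +kernel
  refine (encard_translates_le hO hP (Finset.univ.filter fun x : Parity =>
    x ≠ 0 ∧ (x.1, x.2.1) ≠ edgeClass j) ?_).trans (by rw [hcard]; norm_num)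
  intro a b c hd hQ
  simp only [Finset.mem_filter, Finset.mem_univ, true_and]
  constructor
  · intro e
    obtain ⟨k, l, m, hklm, ha, hb, hc⟩ := exists_eq_add_two_of_parity_eq (a := 0) (b := 0)
      (c := 0) (by norm_num) hd (by rw [e]; simp [parity])
    rw [zero_add] at ha hb hc
    subst ha hb hc
    exact IsStrictNeighbor.not_even hs hh hO hP hklm hQ
  · intro e
    have hPi := hni P hP
    -- If equality held, P would be fixed by a rotation followed by a horizontal lattice
    -- translation, which is a rotation about another integer axis; the witnesses below are the
    -- coordinates of that axis.
    have hne : ∀ i k : ℤ, hexRotAt i k P ≠ P + intVec a b c ∧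
        hexRotAt i k (hexRotAt i k P) ≠ P + intVec a b c := by
      intro i k
      have hz : ∀ v : ℝ × ℝ × ℝ, v.2.2 = P.2.2 → v = P + intVec a b c → c = 0 := by
        rintro v hv rfl
        simpa [intVec] using hv
      constructor
      · intro e
        have hc := hz _ (hexRotAt_snd_snd _ _ _) e
        simp only [hexRotAt, hexRot, intVec, Prod.ext_iff, Prod.fst_add, Prod.snd_add] at e
        push_cast at e
        obtain ⟨t, ht⟩ := hd
        obtain rfl : a = 3 * t - b := by omega
        push_cast at e
        exact hPi ⟨i + b - 2 * t, k - t, by push_cast; linarith [e.1, e.2.1],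
          by push_cast; linarith [e.1, e.2.1]⟩
      · intro e
        have hc := hz _ (by rw [hexRotAt_snd_snd, hexRotAt_snd_snd]) e
        simp only [hexRotAt, hexRot, intVec, Prod.ext_iff, Prod.fst_add, Prod.snd_add] at e
        push_cast at e
        obtain ⟨t, ht⟩ := hd
        obtain rfl : a = 3 * t - b := by omega
        push_cast at e
        exact hPi ⟨i - t, k - b + t, by push_cast; linarith [e.1, e.2.1],
          by push_cast; linarith [e.1, e.2.1]⟩
    exact not_admissible_of_edgeClass hup hup h1 h2 e
      (hQ.admissible hs hO hP hPi (hni _ hQ.1) hup.nonneg hup.le hup.le_one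
        (fun i k => (hne i k).1) (fun i k => (hne i k).2))

/-- Shading says nothing about copies of P rotated about an integer axis, and these lie at the
height of P. So each of the two nontrivial rotations loses only the label of odd vertical parity
over its excluded edge, leaving 16 - 2. -/
theorem encard_own_rotations_le (hs : 0 < s) (hO : IsRhombohedral O) (hP : P ∈ O)
    (hup : InUpTriangle P) (hni : ∀ Q ∈ O, ¬ ∃ i j : ℤ, Q.1 = i ∧ Q.2.1 = j) :
    {Q | IsStrictNeighbor s h O P Q ∧
      (¬ ∃ a b c : ℤ, 3 ∣ a + b - c ∧ Q = P + intVec a b c) ∧ InCoset P Q}.encard ≤ 14 := by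
  have hnn : ∀ j, 0 ≤ barycentric P j := by
    intro j
    have := hup.nonneg
    have := hup.le
    have := hup.le_one
    fin_cases j <;> simp [barycentric] <;> linarith
  choose J hJ using exists_own_edge (barycentric P) hnn
  have hcard : ∀ j k : Fin 3, (Finset.univ.filter fun x : Fin 3 × Parity =>
      x.1 ≠ 0 ∧ ¬ (x.1 = 1 ∧ (x.2.1, x.2.2.1) = edgeClass j ∧ x.2.2.2 = 1) ∧
      ¬ (x.1 = 2 ∧ (x.2.1, x.2.2.1) = edgeClass k ∧ x.2.2.2 = 1)).card ≤ 14 := by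
    decide +kernel
  have hodd : ∀ κ : Fin 3, κ = 1 ∨ κ = 2 → ∀ a b c : ℤ,
      IsStrictNeighbor s h O P (upBase P κ + intVec a b c) →
      ((a : ZMod 2), (b : ZMod 2)) = edgeClass (J κ) → (c : ZMod 2) ≠ 1 := by
    intro κ hκ a b c hQ e hc
    obtain ⟨c', rfl⟩ := odd_iff_cast_zmod_two.2 hc
    -- The vertical shifts 4 and 2 in `upBase` are even, so an odd vertical translation changes the
    -- height.
    have hz : (upBase P κ + intVec a b (2 * c' + 1)).2.2 ≠ P.2.2 := by
      intro e
      rcases hκ with rfl | rfl <;> simp [upBase, hexRot, intVec] at e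
      · have : ((4 + (2 * c' + 1) : ℤ) : ℝ) = ((0 : ℤ) : ℝ) := by push_cast; linarith
        have := Int.cast_injective this
        omega
      · have : ((2 + (2 * c' + 1) : ℤ) : ℝ) = ((0 : ℤ) : ℝ) := by push_cast; linarith
        have := Int.cast_injective this
        omega
    refine not_admissible_of_edgeClass hup (hup.upBase κ) (j := J κ) (m := a) (n := b) ?_ ?_ e
      (hQ.admissible hs hO hP (hni P hP) (hni _ hQ.1) hup.nonneg hup.le hup.le_one ?_ ?_)
    · rw [barycentric_upBase, barycentric_upBase]
      exact (hJ κ).1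
    · rw [barycentric_upBase, barycentric_upBase]
      exact (hJ κ).2
    · exact fun i j e => hz (by rw [← e, hexRotAt_snd_snd])
    · exact fun i j e => hz (by rw [← e, hexRotAt_snd_snd, hexRotAt_snd_snd])
  refine (encard_le_of_parity (s := s) (h := h) hO hP (fun Q hQ => hQ.1)
    (fun Q hQ a b c hd e => hQ.2.1 ⟨a, b, c, hd, e⟩) (upBase P) _ ?_).trans
    (Nat.cast_le.2 (hcard (J 1) (J 2)))
  rintro Q ⟨hQ, hQP, hQS⟩
  obtain ⟨κ, a, b, c, hd, rfl⟩ := hQS.exists_upBase (B := P) (k := 0) (l := 0) (m := 0)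
    (by norm_num) (by simp [intVec])
  refine ⟨κ, a, b, c, hd, rfl, ?_⟩
  simp only [Finset.mem_filter, Finset.mem_univ, true_and, parity]
  refine ⟨?_, ?_, ?_⟩
  · rintro rfl
    exact hQP ⟨a, b, c, hd, rfl⟩
  · rintro ⟨rfl, h1, h2⟩
    exact hodd 1 (Or.inl rfl) a b c hQ h1 h2
  · rintro ⟨rfl, h1, h2⟩
    exact hodd 2 (Or.inr rfl) a b c hQ h1 h2

theorem encard_strictNeighbor_of_axis (hs : 0 < s) (hh : 0 < h) (hO : IsRhombohedral O)
    (hP : P ∈ O) {S : Fin 4 → ℝ × ℝ × ℝ} (hS : S 0 = P)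
    (hcover : ∀ Q ∈ O, ∃ j, InCoset (S j) Q)
    (hint : ∀ j, ∃ i k : ℤ, (S j).1 = i ∧ (S j).2.1 = k) :
    {Q | IsStrictNeighbor s h O P Q}.encard ≤ 38 := by
  have hcard : (Finset.univ.filter fun x : Parity => x ≠ 0).card = 7 := by decide +kernel
  have hcard' : (Finset.univ.filter fun x : Fin 4 × Parity => x.1 ≠ 0).card = 24 := by
    decide +kernel
  have hid := encard_translates_le (s := s) (h := h) hO hP
    (Finset.univ.filter fun x : Parity => x ≠ 0) (by
      intro a b c hd hQ
      simp only [Finset.mem_filter, Finset.mem_univ, true_and]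
      intro e
      obtain ⟨k, l, m, hklm, ha, hb, hc⟩ := exists_eq_add_two_of_parity_eq (a := 0) (b := 0)
        (c := 0) (by norm_num) hd (by rw [e]; simp [parity])
      rw [zero_add] at ha hb hc
      subst ha hb hc
      exact IsStrictNeighbor.not_even hs hh hO hP hklm hQ)
  have hrest := encard_le_of_parity (s := s) (h := h) (M := {Q | IsStrictNeighbor s h O P Q ∧
    ¬ ∃ a b c : ℤ, 3 ∣ a + b - c ∧ Q = P + intVec a b c}) hO hP (fun Q hQ => hQ.1)
    (fun Q hQ a b c hd e => hQ.2 ⟨a, b, c, hd, e⟩) S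
    (Finset.univ.filter fun x : Fin 4 × Parity => x.1 ≠ 0) (by
      rintro Q ⟨hQ, hQP⟩
      obtain ⟨j, hj⟩ := hcover Q hQ.1
      obtain ⟨a, b, c, hd, he⟩ := hj.exists_add_intVec (hint j)
      refine ⟨j, a, b, c, hd, he, ?_⟩
      simp only [Finset.mem_filter, Finset.mem_univ, true_and]
      rintro rfl
      exact hQP ⟨a, b, c, hd, hS ▸ he⟩)
  rw [hcard] at hid
  rw [hcard'] at hrest
  refine (Set.encard_mono ?_).trans ((Set.encard_union_le _ _).trans
    ((add_le_add hid hrest).trans (by norm_num)))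
  intro Q hQ
  by_cases hc : ∃ a b c : ℤ, 3 ∣ a + b - c ∧ Q = P + intVec a b c
  · exact Or.inl ⟨hQ, hc⟩
  · exact Or.inr ⟨hQ, hc⟩

theorem encard_strictNeighbor_of_not_axis (hs : 0 < s) (hh : 0 < h) (hO : IsRhombohedral O)
    (hP : P ∈ O) (hup : InUpTriangle P) {S : Fin 4 → ℝ × ℝ × ℝ} (hS : S 0 = P)
    (hcover : ∀ Q ∈ O, ∃ j, InCoset (S j) Q)
    (hni : ∀ Q ∈ O, ¬ ∃ i j : ℤ, Q.1 = i ∧ Q.2.1 = j) :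
    {Q | IsStrictNeighbor s h O P Q}.encard ≤ 78 := by
  have h1 := encard_translates_le_ten hs hh hO hP hup hni
  have h2 := encard_own_rotations_le (h := h) hs hO hP hup hni
  have h3 := fun j => encard_other_coset_le (h := h) hs hO hP hup hni (S j)
  refine (Set.encard_mono ?_).trans ((Set.encard_union_le _ _).trans ((add_le_add
    ((Set.encard_union_le _ _).trans ((add_le_add
      ((Set.encard_union_le _ _).trans ((add_le_add
        ((Set.encard_union_le _ _).trans (add_le_add h1 h2)) (h3 1)))) (h3 2)))) (h3 3)).trans
    (by norm_num)))
  intro Q hQ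
  rw [Set.mem_ofPred_eq] at hQ
  by_cases hown : InCoset P Q
  · left; left; left
    by_cases hc : ∃ a b c : ℤ, 3 ∣ a + b - c ∧ Q = P + intVec a b c
    · exact Or.inl ⟨hQ, hc⟩
    · exact Or.inr ⟨hQ, hc, hown⟩
  · obtain ⟨j, hj⟩ := hcover Q hQ.1
    fin_cases j
    · exact absurd (hS ▸ hj) hown
    · left; left; right
      exact ⟨hQ, hown, hj⟩
    · left; right
      exact ⟨hQ, hown, hj⟩
    · right
      exact ⟨hQ, hown, hj⟩

end Count

/-! ### The four cosets in an orbit of the standard group -/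

/-- The horizontal rotation of order two of the standard group, in scaled hexagonal
coordinates. -/
noncomputable def hexFlip (v : ℝ × ℝ × ℝ) : ℝ × ℝ × ℝ := (v.1, v.1 - v.2.1, 3 / 2 - v.2.2)

/-- Base points of the four cosets of the rotation and translation part in an orbit. -/
noncomputable def cosetBase (p : ℝ × ℝ × ℝ) : Fin 4 → ℝ × ℝ × ℝ := ![p, -p, hexFlip p, -hexFlip p]

theorem InCoset.add {S Q : ℝ × ℝ × ℝ} (hQ : InCoset S Q) {a b c : ℤ} (hd : 3 ∣ a + b - c) :
    InCoset S (Q + intVec a b c) := by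
  obtain ⟨κ, k, l, m, hd', rfl⟩ := hQ
  exact ⟨κ, k + a, l + b, m + c, by omega, by rw [← intVec_add, add_assoc]⟩

theorem InCoset.rot {S Q : ℝ × ℝ × ℝ} (hQ : InCoset S Q) : InCoset S (hexRot Q) := by
  obtain ⟨κ, k, l, m, hd', rfl⟩ := hQ
  fin_cases κ
  · refine ⟨1, -l, k - l, m, by omega, ?_⟩
    simp [hexRot, intVec]
    constructor <;> ring
  · refine ⟨2, -l, k - l, m, by omega, ?_⟩
    simp [hexRot, intVec]
    constructor <;> ring
  · refine ⟨0, -l, k - l, m, by omega, ?_⟩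
    simp [hexRot, intVec, Prod.ext_iff]
    constructor <;> ring

theorem InCoset.neg {S Q : ℝ × ℝ × ℝ} (hQ : InCoset S Q) : InCoset (-S) (-Q) := by
  obtain ⟨κ, k, l, m, hd', rfl⟩ := hQ
  refine ⟨κ, -k, -l, -m, by omega, ?_⟩
  fin_cases κ <;> simp [hexRot, intVec, Prod.ext_iff] <;> refine ⟨?_, ?_, ?_⟩ <;> ring

theorem InCoset.flip {S Q : ℝ × ℝ × ℝ} (hQ : InCoset S Q) : InCoset (hexFlip S) (hexFlip Q) := by
  obtain ⟨κ, k, l, m, hd', rfl⟩ := hQ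
  fin_cases κ
  · refine ⟨0, k, k - l, -m, by omega, ?_⟩
    simp [intVec, hexFlip]
    constructor <;> ring
  · refine ⟨2, k, k - l, -m, by omega, ?_⟩
    simp [hexRot, intVec, hexFlip]
    constructor <;> ring
  · refine ⟨1, k, k - l, -m, by omega, ?_⟩
    simp [hexRot, intVec, hexFlip]
    constructor <;> ring

theorem InCoset.of_add_vertical {S Q : ℝ × ℝ × ℝ} (hQ : InCoset (S + intVec 0 0 3) Q) :
    InCoset S Q := by
  obtain ⟨κ, k, l, m, hd', rfl⟩ := hQ
  refine ⟨κ, k, l, m + 3, by omega, ?_⟩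
  fin_cases κ <;> simp [hexRot, intVec, Prod.ext_iff] <;> ring

theorem hexFlip_hexFlip (v : ℝ × ℝ × ℝ) : hexFlip (hexFlip v) = v := by
  simp [hexFlip]

theorem hexFlip_neg (v : ℝ × ℝ × ℝ) : hexFlip (-v) = -hexFlip v + intVec 0 0 3 := by
  simp [hexFlip, intVec]
  constructor <;> ring

theorem exists_inCoset_neg {p Q : ℝ × ℝ × ℝ} (hQ : ∃ j, InCoset (cosetBase p j) Q) :
    ∃ j, InCoset (cosetBase p j) (-Q) := by
  obtain ⟨j, hj⟩ := hQ
  have := hj.neg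
  fin_cases j
  · exact ⟨1, this⟩
  · exact ⟨0, by simpa [cosetBase] using this⟩
  · exact ⟨3, this⟩
  · exact ⟨2, by simpa [cosetBase] using this⟩

theorem exists_inCoset_flip {p Q : ℝ × ℝ × ℝ} (hQ : ∃ j, InCoset (cosetBase p j) Q) :
    ∃ j, InCoset (cosetBase p j) (hexFlip Q) := by
  obtain ⟨j, hj⟩ := hQ
  have := hj.flip
  fin_cases j
  · exact ⟨2, this⟩
  -- The flip and the inversion commute only up to the lattice vector (0, 0, 3).
  · refine ⟨3, InCoset.of_add_vertical ?_⟩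
    simpa [cosetBase, hexFlip_neg] using this
  · exact ⟨0, by simpa [cosetBase, hexFlip_hexFlip] using this⟩
  · refine ⟨1, InCoset.of_add_vertical ?_⟩
    simpa [cosetBase, hexFlip_neg, hexFlip_hexFlip] using this

theorem InCoset.exists_int {S Q : ℝ × ℝ × ℝ} (hQ : InCoset S Q)
    (h : ∃ i j : ℤ, Q.1 = i ∧ Q.2.1 = j) : ∃ i j : ℤ, S.1 = i ∧ S.2.1 = j := by
  obtain ⟨κ, a, b, c, -, rfl⟩ := hQ
  obtain ⟨i, j, hi, hj⟩ := h
  fin_cases κ <;> simp [hexRot, intVec] at hi hj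
  · exact ⟨i - a, j - b, by push_cast; linarith, by push_cast; linarith⟩
  · exact ⟨j - b + a - i, a - i, by push_cast; linarith, by push_cast; linarith⟩
  · exact ⟨b - j, i - a + b - j, by push_cast; linarith, by push_cast; linarith⟩

theorem exists_int_cosetBase_iff {p : ℝ × ℝ × ℝ} (j : Fin 4) :
    (∃ i k : ℤ, (cosetBase p j).1 = i ∧ (cosetBase p j).2.1 = k) ↔
      ∃ i k : ℤ, p.1 = i ∧ p.2.1 = k := by
  fin_cases j <;> simp only [cosetBase, hexFlip] <;> constructor <;> rintro ⟨i, k, hi, hk⟩ <;>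
    simp at hi hk ⊢
  · exact ⟨⟨i, hi⟩, ⟨k, hk⟩⟩
  · exact ⟨⟨i, hi⟩, ⟨k, hk⟩⟩
  · exact ⟨⟨-i, by push_cast; linarith⟩, ⟨-k, by push_cast; linarith⟩⟩
  · exact ⟨⟨-i, by push_cast; linarith⟩, ⟨-k, by push_cast; linarith⟩⟩
  · exact ⟨⟨i, hi⟩, ⟨i - k, by push_cast; linarith⟩⟩
  · exact ⟨⟨i, hi⟩, ⟨i - k, by push_cast; linarith⟩⟩
  · exact ⟨⟨-i, by push_cast; linarith⟩, ⟨k - i, by push_cast; linarith⟩⟩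
  · exact ⟨⟨-i, by push_cast; linarith⟩, ⟨k - i, by push_cast; linarith⟩⟩

/-- The bound on strict neighbours for an orbit of the standard group. -/
theorem encard_strictNeighbor_le {s h : ℝ} (hs : 0 < s) (hh : 0 < h) {O : Set (ℝ × ℝ × ℝ)}
    (hO : IsRhombohedral O) {P : ℝ × ℝ × ℝ} (hP : P ∈ O) (hup : InUpTriangle P)
    (hcover : ∀ Q ∈ O, ∃ j, InCoset (cosetBase P j) Q) :
    {Q | IsStrictNeighbor s h O P Q}.encard ≤ 78 := by
  by_cases hint : ∃ i k : ℤ, P.1 = i ∧ P.2.1 = k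
  · exact (encard_strictNeighbor_of_axis hs hh hO hP (S := cosetBase P) rfl hcover
      fun j => (exists_int_cosetBase_iff j).2 hint).trans (by norm_num)
  · refine encard_strictNeighbor_of_not_axis hs hh hO hP hup (S := cosetBase P) rfl hcover ?_
    intro Q hQ hQi
    obtain ⟨j, hj⟩ := hcover Q hQ
    exact hint ((exists_int_cosetBase_iff j).1 (hj.exists_int hQi))

/-- Scaled hexagonal coordinates, in which the translations of the rhombohedral lattice are
integral. -/
def rhombCoord (v : Fin 3 → ℝ) : ℝ × ℝ × ℝ := (v 0 + v 1, 2 * v 1 - v 0, 3 * v 2)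

theorem rhombCoord_injective : Function.Injective rhombCoord := by
  intro v w h
  simp only [rhombCoord, Prod.mk.injEq] at h
  obtain ⟨h1, h2, h3⟩ := h
  ext i
  fin_cases i
  · change v 0 = w 0
    linarith
  · change v 1 = w 1
    linarith
  · change v 2 = w 2
    linarith

namespace R3c

theorem trans_add (v w : Fin 3 → ℝ) : trans (v + w) = trans v * trans w :=
  AffineEquiv.constVAdd_add ℝ _ v w

theorem trans_zsmul (n : ℤ) (v : Fin 3 → ℝ) : trans (n • v) = trans v ^ n :=
  AffineEquiv.constVAdd_zsmul ℝ _ n v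

theorem trans_apply (v w : Fin 3 → ℝ) : trans v w = v + w := rfl

theorem exists_trans_mem_standardGroup {a b c : ℤ} (hd : 3 ∣ a + b - c) :
    ∃ f ∈ standardGroup, ∀ u, rhombCoord (f u) = rhombCoord u + intVec a b c := by
  obtain ⟨m, hm⟩ := hd
  -- The three generators become (1, 0, 1), (1, -1, 0) and (1, 2, 0) under `rhombCoord`; the
  -- coefficients solve for (a, b, c).
  refine ⟨trans (c • ![2 / 3, 1 / 3, 1 / 3] + ((a - c - m) • ![1, 0, 0] + m • ![0, 1, 0])),
    ?_, ?_⟩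
  · rw [trans_add, trans_add, trans_zsmul, trans_zsmul, trans_zsmul]
    refine mul_mem (zpow_mem (Subgroup.subset_closure ?_) _)
      (mul_mem (zpow_mem (Subgroup.subset_closure ?_) _)
        (zpow_mem (Subgroup.subset_closure ?_) _)) <;> simp
  · intro u
    obtain rfl : a = c - b + 3 * m := by omega
    simp only [rhombCoord, trans_apply, intVec, Prod.ext_iff]
    simp
    refine ⟨?_, ?_, ?_⟩ <;> ring

theorem exists_rot_mem_standardGroup :
    ∃ f ∈ standardGroup, ∀ u, rhombCoord (f u) = hexRot (rhombCoord u) := by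
  refine ⟨rot3.toAffineEquiv, Subgroup.subset_closure (by simp), fun u => ?_⟩
  simp [rhombCoord, hexRot, rot3]
  constructor <;> ring

theorem exists_neg_mem_standardGroup :
    ∃ f ∈ standardGroup, ∀ u, rhombCoord (f u) = -rhombCoord u := by
  refine ⟨(LinearEquiv.neg ℝ : (Fin 3 → ℝ) ≃ₗ[ℝ] (Fin 3 → ℝ)).toAffineEquiv,
    Subgroup.subset_closure (by simp), fun u => ?_⟩
  simp [rhombCoord]
  constructor <;> ring

theorem exists_inCoset_generator {s : (Fin 3 → ℝ) ≃ᵃ[ℝ] (Fin 3 → ℝ)}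
    (hs : s ∈ ({trans ![1, 0, 0], trans ![0, 1, 0], trans ![0, 0, 1], trans ![2 / 3, 1 / 3, 1 / 3],
      rot3.toAffineEquiv, rot2.toAffineEquiv.trans (trans ![0, 0, 1 / 2]),
      (LinearEquiv.neg ℝ : (Fin 3 → ℝ) ≃ₗ[ℝ] (Fin 3 → ℝ)).toAffineEquiv} : Set _))
    (p : ℝ × ℝ × ℝ) (u : Fin 3 → ℝ) :
    ((∃ j, InCoset (cosetBase p j) (rhombCoord u)) →
      ∃ j, InCoset (cosetBase p j) (rhombCoord (s u))) ∧
    ((∃ j, InCoset (cosetBase p j) (rhombCoord u)) →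
      ∃ j, InCoset (cosetBase p j) (rhombCoord (s⁻¹ u))) := by
  have htrans : ∀ (v u : Fin 3 → ℝ) (a b c : ℤ), 3 ∣ a + b - c → rhombCoord v = intVec a b c →
      ((∃ j, InCoset (cosetBase p j) (rhombCoord u)) →
        ∃ j, InCoset (cosetBase p j) (rhombCoord (trans v u))) ∧
      ((∃ j, InCoset (cosetBase p j) (rhombCoord u)) →
        ∃ j, InCoset (cosetBase p j) (rhombCoord ((trans v)⁻¹ u))) := by
    intro v u a b c hd hv
    constructor
    · rintro ⟨j, hj⟩
      refine ⟨j, ?_⟩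
      convert hj.add hd using 1
      rw [← hv, trans_apply]
      simp [rhombCoord]
      refine ⟨?_, ?_, ?_⟩ <;> ring
    · rintro ⟨j, hj⟩
      refine ⟨j, ?_⟩
      convert hj.add (a := -a) (b := -b) (c := -c) (by omega) using 1
      have h1 : (trans v)⁻¹ u = -v + u := rfl
      have h2 : intVec (-a) (-b) (-c) = -rhombCoord v := by rw [hv]; simp [intVec]
      rw [h1, h2]
      simp [rhombCoord]
      refine ⟨?_, ?_, ?_⟩ <;> ring
  simp only [Set.mem_insert_iff, Set.mem_singleton_iff] at hs
  rcases hs with rfl | rfl | rfl | rfl | rfl | rfl | rfl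
  · exact htrans _ u 1 (-1) 0 (by norm_num) (by simp [rhombCoord, intVec])
  · exact htrans _ u 1 2 0 (by norm_num) (by simp [rhombCoord, intVec])
  · exact htrans _ u 0 0 3 (by norm_num) (by simp [rhombCoord, intVec])
  · exact htrans _ u 1 0 1 (by norm_num) (by simp [rhombCoord, intVec]; norm_num)
  · constructor
    · rintro ⟨j, hj⟩
      refine ⟨j, ?_⟩
      convert hj.rot using 1
      simp [rhombCoord, hexRot, rot3]
      constructor <;> ring
    · rintro ⟨j, hj⟩
      refine ⟨j, ?_⟩
      convert hj.rot.rot using 1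
      have h1 : (rot3.toAffineEquiv)⁻¹ u = ![u 1 - u 0, -u 0, u 2] := rfl
      rw [h1]
      simp [rhombCoord, hexRot]
      constructor <;> ring
  · constructor
    · intro h
      convert exists_inCoset_flip h using 3
      simp [rhombCoord, hexFlip, rot2, trans_apply]
      refine ⟨?_, ?_, ?_⟩ <;> ring
    · intro h
      convert exists_inCoset_flip h using 3
      have h1 : ∀ v : Fin 3 → ℝ, (rot2.toAffineEquiv.trans (trans v))⁻¹ u =
        ![(-v + u) 1, (-v + u) 0, -(-v + u) 2] := fun _ => rfl
      rw [h1]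
      simp [rhombCoord, hexFlip]
      refine ⟨?_, ?_, ?_⟩ <;> ring
  · constructor
    · intro h
      convert exists_inCoset_neg h using 3
      simp [rhombCoord]
      constructor <;> ring
    · intro h
      convert exists_inCoset_neg h using 3
      have h1 : ((LinearEquiv.neg ℝ : (Fin 3 → ℝ) ≃ₗ[ℝ] (Fin 3 → ℝ)).toAffineEquiv)⁻¹ u = -u :=
        rfl
      rw [h1]
      simp [rhombCoord]
      constructor <;> ring

theorem exists_inCoset_of_mem_standardGroup {f : (Fin 3 → ℝ) ≃ᵃ[ℝ] (Fin 3 → ℝ)}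
    (hf : f ∈ standardGroup) (u : Fin 3 → ℝ) :
    ∃ j, InCoset (cosetBase (rhombCoord u) j) (rhombCoord (f u)) := by
  induction hf using Subgroup.closure_induction_left with
  | one => exact ⟨0, 0, 0, 0, 0, by norm_num, by simp [cosetBase, intVec]⟩
  | mul_left s hs y hy ih => exact (exists_inCoset_generator hs _ (y u)).1 ih
  | inv_mul_cancel s hs y hy ih => exact (exists_inCoset_generator hs _ (y u)).2 ih

end R3c

/-! ### Transfer to an isometry group of Euclidean space -/

theorem IsTypeR3c.exists_coordinates {G : Subgroup (E3 ≃ᵃⁱ[ℝ] E3)} (hG : IsTypeR3c G) :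
    ∃ φ : E3 ≃ᵃ[ℝ] (Fin 3 → ℝ),
      (∀ g ∈ G, ∃ f ∈ R3c.standardGroup, ∀ x, φ (g x) = f (φ x)) ∧
      ∀ f ∈ R3c.standardGroup, ∃ g ∈ G, ∀ x, φ (g x) = f (φ x) := by
  obtain ⟨φ, hφ⟩ := hG
  refine ⟨φ, fun g hg => ?_, fun f hf => ?_⟩
  · refine ⟨(φ.symm.trans g.toAffineEquiv).trans φ, ?_, fun x => by simp⟩
    rw [← SetLike.mem_coe, ← hφ]
    exact ⟨g, hg, rfl⟩
  · rw [← SetLike.mem_coe, ← hφ] at hf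
    obtain ⟨g, hg, rfl⟩ := hf
    exact ⟨g, hg, fun x => by simp⟩

/-- Invariance under the threefold rotation fixes the Gram matrix up to two scales: the horizontal
basis vectors have equal length and enclose 120°, and the vertical one is orthogonal to both.
`rhombCoord` multiplies squared lengths by 3 horizontally and 9 vertically. -/
theorem exists_hexSqDist_eq {φ : E3 ≃ᵃ[ℝ] (Fin 3 → ℝ)} {g : E3 ≃ᵃⁱ[ℝ] E3}
    (hg : ∀ x, φ (g x) = R3c.rot3 (φ x)) : ∃ s h : ℝ, 0 < s ∧ 0 < h ∧
      ∀ x y, dist x y ^ 2 = hexSqDist s h (rhombCoord (φ x)) (rhombCoord (φ y)) := by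
  obtain ⟨L, hL⟩ : ∃ L : (Fin 3 → ℝ) ≃ₗ[ℝ] E3, ∀ x y, x - y = L (φ x - φ y) := by
    refine ⟨φ.linear.symm, fun x y => ?_⟩
    rw [LinearEquiv.eq_symm_apply, ← vsub_eq_sub, ← vsub_eq_sub]
    exact φ.toAffineMap.linearMap_vsub x y
  have hrot : ∀ u, ‖L (R3c.rot3 u)‖ = ‖L u‖ := by
    intro u
    have h1 := hL (φ.symm u) (φ.symm 0)
    have h2 := hL (g (φ.symm u)) (g (φ.symm 0))
    rw [hg, hg, φ.apply_symm_apply, φ.apply_symm_apply, map_zero R3c.rot3, sub_zero] at h2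
    rw [φ.apply_symm_apply, φ.apply_symm_apply, sub_zero] at h1
    rw [← h1, ← h2, ← dist_eq_norm, ← dist_eq_norm, g.dist_map]
  obtain ⟨e0, he0⟩ : ∃ e, e = L ![1, 0, 0] := ⟨_, rfl⟩
  obtain ⟨e1, he1⟩ : ∃ e, e = L ![0, 1, 0] := ⟨_, rfl⟩
  obtain ⟨e2, he2⟩ : ∃ e, e = L ![0, 0, 1] := ⟨_, rfl⟩
  have hexp : ∀ u, L u = u 0 • e0 + u 1 • e1 + u 2 • e2 := by
    intro u
    rw [he0, he1, he2, ← map_smul, ← map_smul, ← map_smul, ← map_add, ← map_add]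
    congr 1
    ext i
    fin_cases i <;> simp
  have hnorm : ∀ u, ‖L u‖ ^ 2 = u 0 ^ 2 * ⟪e0, e0⟫ + u 1 ^ 2 * ⟪e1, e1⟫ + u 2 ^ 2 * ⟪e2, e2⟫ +
      2 * (u 0 * u 1 * ⟪e0, e1⟫ + u 0 * u 2 * ⟪e0, e2⟫ + u 1 * u 2 * ⟪e1, e2⟫) := by
    intro u
    rw [hexp, ← real_inner_self_eq_norm_sq]
    simp only [inner_add_left, inner_add_right, real_inner_smul_left, real_inner_smul_right,
      real_inner_comm e0 e1, real_inner_comm e0 e2, real_inner_comm e1 e2]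
    ring
  have hinv : ∀ u, ‖L (R3c.rot3 u)‖ ^ 2 = ‖L u‖ ^ 2 := fun u => by rw [hrot]
  have i1 := hinv ![1, 0, 0]
  have i2 := hinv ![0, 1, 0]
  have i3 := hinv ![1, 0, 1]
  have i4 := hinv ![0, 1, 1]
  simp only [hnorm, R3c.rot3] at i1 i2 i3 i4
  simp at i1 i2 i3 i4
  have hp0 : 0 < ⟪e0, e0⟫ := by
    rw [real_inner_self_pos, he0, Ne, LinearEquiv.map_eq_zero_iff]
    intro h
    simpa using congrFun h 0
  have hp2 : 0 < ⟪e2, e2⟫ := by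
    rw [real_inner_self_pos, he2, Ne, LinearEquiv.map_eq_zero_iff]
    intro h
    simpa using congrFun h 2
  simp only [← real_inner_self_eq_norm_sq] at i1 i2 i3 i4
  have f1 : ⟪e1, e1⟫ = ⟪e0, e0⟫ := by
    rw [real_inner_self_eq_norm_sq, real_inner_self_eq_norm_sq, i1]
  have f2 : ⟪e0, e1⟫ = -⟪e0, e0⟫ / 2 := by linarith
  have f3 : ⟪e1, e2⟫ = 0 := by linarith
  have f4 : ⟪e0, e2⟫ = 0 := by linarith
  refine ⟨⟪e0, e0⟫ / 3, ⟪e2, e2⟫ / 9, by positivity, by positivity, fun x y => ?_⟩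
  rw [dist_eq_norm, hL, hnorm, f1, f2, f3, f4]
  simp only [hexSqDist, rhombCoord, Pi.sub_apply]
  ring

theorem hexSqDist_bounds {s h r : ℝ} (hs : 0 < s) (hh : 0 < h) {v w : ℝ × ℝ × ℝ}
    (hr : hexSqDist s h v w ≤ r) : |v.1 - w.1| ≤ 4 * r / (3 * s) + r / h + 1 ∧
      |v.2.1 - w.2.1| ≤ 4 * r / (3 * s) + r / h + 1 ∧
      |v.2.2 - w.2.2| ≤ 4 * r / (3 * s) + r / h + 1 := by
  have hbound : ∀ d K : ℝ, d ^ 2 ≤ K → |d| ≤ K + 1 := by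
    intro d K hd
    rw [abs_le]
    constructor <;> nlinarith [sq_nonneg (d + 1), sq_nonneg (d - 1), sq_nonneg d]
  simp only [hexSqDist] at hr
  set a := v.1 - w.1
  set b := v.2.1 - w.2.1
  set c := v.2.2 - w.2.2
  have hc := mul_nonneg hh.le (sq_nonneg c)
  have ha1 := mul_nonneg hs.le (sq_nonneg (2 * a - b))
  have hb1 := mul_nonneg hs.le (sq_nonneg (2 * b - a))
  have ha2 := mul_nonneg hs.le (sq_nonneg a)
  have hb2 := mul_nonneg hs.le (sq_nonneg b)
  have hr0 : 0 ≤ r := by nlinarith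
  have h1 : 0 ≤ 4 * r / (3 * s) := by positivity
  have h2 : 0 ≤ r / h := by positivity
  have k1 : a ^ 2 ≤ 4 * r / (3 * s) := by
    rw [le_div_iff₀ (by positivity)]
    nlinarith
  have k2 : b ^ 2 ≤ 4 * r / (3 * s) := by
    rw [le_div_iff₀ (by positivity)]
    nlinarith
  have k3 : c ^ 2 ≤ r / h := by
    rw [le_div_iff₀ hh]
    nlinarith
  exact ⟨hbound _ _ (by linarith), hbound _ _ (by linarith), hbound _ _ (by linarith)⟩

theorem finite_setOf_intVec_near (B x : ℝ × ℝ × ℝ) (K : ℝ) :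
    {Q | (∃ a b c : ℤ, Q = B + intVec a b c) ∧ |x.1 - Q.1| ≤ K ∧ |x.2.1 - Q.2.1| ≤ K ∧
      |x.2.2 - Q.2.2| ≤ K}.Finite := by
  have hmem : ∀ (y z : ℝ) (n : ℤ), |y - (z + n)| ≤ K →
      n ∈ Set.Icc ⌊y - z - K⌋ ⌈y - z + K⌉ := by
    intro y z n hn
    rw [abs_le] at hn
    constructor
    · exact_mod_cast (Int.floor_le _).trans (by linarith : y - z - K ≤ n)
    · exact_mod_cast (by linarith : (n : ℝ) ≤ y - z + K).trans (Int.le_ceil _)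
  refine (((Set.finite_Icc ⌊x.1 - B.1 - K⌋ ⌈x.1 - B.1 + K⌉).prod
    ((Set.finite_Icc ⌊x.2.1 - B.2.1 - K⌋ ⌈x.2.1 - B.2.1 + K⌉).prod
      (Set.finite_Icc ⌊x.2.2 - B.2.2 - K⌋ ⌈x.2.2 - B.2.2 + K⌉))).image
        fun t : ℤ × ℤ × ℤ => B + intVec t.1 t.2.1 t.2.2).subset ?_
  rintro _ ⟨⟨a, b, c, rfl⟩, h1, h2, h3⟩
  exact ⟨(a, b, c), ⟨hmem _ _ _ h1, hmem _ _ _ h2, hmem _ _ _ h3⟩, rfl⟩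

theorem orbitOf_eq_of_mem {G : Subgroup (E3 ≃ᵃⁱ[ℝ] E3)} {P P' : E3} (h : P' ∈ orbitOf G P) :
    orbitOf G P' = orbitOf G P := by
  obtain ⟨g, hg, rfl⟩ := h
  ext Q
  constructor
  · rintro ⟨k, hk, rfl⟩
    exact ⟨k * g, mul_mem hk hg, rfl⟩
  · rintro ⟨k, hk, rfl⟩
    refine ⟨k * g⁻¹, mul_mem hk (inv_mem hg), ?_⟩
    have : g⁻¹ (g P) = P := g.symm_apply_apply P
    change k (g⁻¹ (g P)) = k P
    rw [this]

theorem StrictlyAdjacent.map {G : Subgroup (E3 ≃ᵃⁱ[ℝ] E3)} {A P Q : E3}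
    (hQ : StrictlyAdjacent (orbitOf G A) P Q) {g : E3 ≃ᵃⁱ[ℝ] E3} (hg : g ∈ G) :
    StrictlyAdjacent (orbitOf G A) (g P) (g Q) := by
  have hmem : ∀ R ∈ orbitOf G A, ∀ k ∈ G, k R ∈ orbitOf G A := by
    rintro _ ⟨l, hl, rfl⟩ k hk
    exact ⟨k * l, mul_mem hk hl, rfl⟩
  obtain ⟨hQS, hQP, w, hw, hlt⟩ := hQ
  refine ⟨hmem Q hQS g hg, g.injective.ne hQP, g w, by rw [g.dist_map, g.dist_map, hw], ?_⟩
  intro R hR hRP hRQ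
  have e : g (g⁻¹ R) = R := g.apply_symm_apply R
  rw [← e, g.dist_map, g.dist_map]
  refine hlt _ (hmem R hR _ (inv_mem hg)) ?_ ?_
  · intro h
    exact hRP (by rw [← e, h])
  · intro h
    exact hRQ (by rw [← e, h])

theorem IsTypeR3c.isLocallyFinite_and_encard_le {G : Subgroup (E3 ≃ᵃⁱ[ℝ] E3)}
    (hG : IsTypeR3c G) (P : E3) : IsLocallyFinite (orbitOf G P) ∧
      {Q | StrictlyAdjacent (orbitOf G P) P Q}.encard ≤ 78 := by
  obtain ⟨φ, hfwd, hbwd⟩ := hG.exists_coordinates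
  obtain ⟨ψ, hψ⟩ : ∃ ψ : E3 → ℝ × ℝ × ℝ, ∀ x, ψ x = rhombCoord (φ x) := ⟨_, fun _ => rfl⟩
  have hinj : Function.Injective ψ := fun x y e =>
    φ.injective (rhombCoord_injective (by rw [← hψ, ← hψ, e]))
  obtain ⟨g₀, -, hg₀⟩ := hbwd R3c.rot3.toAffineEquiv (Subgroup.subset_closure (by simp))
  obtain ⟨s, h, hs, hh, hdist⟩ := exists_hexSqDist_eq hg₀
  simp only [← hψ] at hdist
  have hcover : ∀ A, ∀ y ∈ orbitOf G A, ∃ j, InCoset (cosetBase (ψ A) j) (ψ y) := by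
    rintro A _ ⟨g, hg, rfl⟩
    obtain ⟨f, hf, hfg⟩ := hfwd g hg
    rw [hψ, hψ, hfg]
    exact R3c.exists_inCoset_of_mem_standardGroup hf _
  have hact : ∀ f ∈ R3c.standardGroup, ∀ x ∈ orbitOf G P, ∃ y ∈ orbitOf G P,
      ψ y = rhombCoord (f (φ x)) := by
    rintro f hf _ ⟨k, hk, rfl⟩
    obtain ⟨g, hg, hgf⟩ := hbwd f hf
    exact ⟨g (k P), ⟨g * k, mul_mem hg hk, rfl⟩, by rw [hψ, hgf]⟩
  have hO : IsRhombohedral (ψ '' orbitOf G P) := by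
    constructor
    · rintro _ ⟨x, hx, rfl⟩ a b c hd
      obtain ⟨f, hf, hfu⟩ := R3c.exists_trans_mem_standardGroup hd
      obtain ⟨y, hy, hyx⟩ := hact f hf x hx
      exact ⟨y, hy, by rw [hyx, hfu, hψ]⟩
    · rintro _ ⟨x, hx, rfl⟩
      obtain ⟨f, hf, hfu⟩ := R3c.exists_rot_mem_standardGroup
      obtain ⟨y, hy, hyx⟩ := hact f hf x hx
      exact ⟨y, hy, by rw [hyx, hfu, hψ]⟩
  have hneg : ∀ v ∈ ψ '' orbitOf G P, -v ∈ ψ '' orbitOf G P := by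
    rintro _ ⟨x, hx, rfl⟩
    obtain ⟨f, hf, hfu⟩ := R3c.exists_neg_mem_standardGroup
    obtain ⟨y, hy, hyx⟩ := hact f hf x hx
    exact ⟨y, hy, by rw [hyx, hfu, hψ]⟩
  have hP : P ∈ orbitOf G P := ⟨1, one_mem G, rfl⟩
  refine ⟨fun x r => ?_, ?_⟩
  · refine ((Set.finite_iUnion fun j : Fin 4 => Set.finite_iUnion fun κ : Fin 3 =>
      finite_setOf_intVec_near (hexRot^[κ] (cosetBase (ψ P) j)) (ψ x)
        (4 * r ^ 2 / (3 * s) + r ^ 2 / h + 1)).preimage hinj.injOn).subset ?_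
    rintro y ⟨hy, hyr⟩
    obtain ⟨j, κ, a, b, c, -, he⟩ := hcover P y hy
    rw [Metric.mem_closedBall, dist_comm] at hyr
    have hK := hexSqDist_bounds hs hh (v := ψ x) (w := ψ y) (r := r ^ 2) (by
      rw [← hdist]
      exact pow_le_pow_left₀ dist_nonneg hyr 2)
    exact Set.mem_iUnion.2 ⟨j, Set.mem_iUnion.2 ⟨κ, ⟨a, b, c, he⟩, hK⟩⟩
  obtain ⟨_, ⟨P', hP', rfl⟩, hup⟩ : ∃ v ∈ ψ '' orbitOf G P, InUpTriangle v := by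
    obtain ⟨a, b, c, hd, hB⟩ := exists_intVec_inTriangle (ψ P)
    have hmem := hO.add_mem _ ⟨P, hP, rfl⟩ a b c hd
    rcases hB with hB | hB
    · exact ⟨_, hmem, hB⟩
    -- The inversion followed by translation by (1, 1, 2) carries the down triangle onto the up
    -- triangle.
    · refine ⟨_, hO.add_mem _ (hneg _ hmem) 1 1 2 (by norm_num), ?_⟩
      obtain ⟨h1, h2, h3⟩ := hB
      generalize ψ P + intVec a b c = B at h1 h2 h3
      constructor <;> simp [intVec] <;> linarith
  have hbound := encard_strictNeighbor_le hs hh hO ⟨P', hP', rfl⟩ hup (by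
    rintro _ ⟨y, hy, rfl⟩
    exact hcover P' y (by rwa [orbitOf_eq_of_mem hP']))
  have hlt : ∀ x y z, dist x y < dist x z ↔ hexSqDist s h (ψ x) (ψ y) < hexSqDist s h (ψ x) (ψ z) :=
    fun x y z => by rw [← hdist, ← hdist, sq_lt_sq₀ dist_nonneg dist_nonneg]
  have hadj : {Q | StrictlyAdjacent (orbitOf G P) P' Q}.encard ≤ 78 := by
    refine le_trans (Set.encard_le_encard_of_injOn (f := ψ) ?_ hinj.injOn) hbound
    rintro Q ⟨hQS, hQP, w, hw, hwR⟩
    refine ⟨⟨Q, hQS, rfl⟩, hinj.ne hQP, ψ w, by rw [← hdist, ← hdist, hw], ?_⟩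
    rintro _ ⟨R, hR, rfl⟩ hRP hRQ
    exact (hlt _ _ _).1 (hwR R hR (fun e => hRP (by rw [e])) fun e => hRQ (by rw [e]))
  -- The bound was proved at `P'`, the orbit point over the up triangle; the group element taking P
  -- to it maps strict neighbours to strict neighbours.
  obtain ⟨g, hg, rfl⟩ := hP'
  exact le_trans (Set.encard_le_encard_of_injOn (f := g) (fun Q hQ => StrictlyAdjacent.map hQ hg)
    g.injective.injOn) hadj

theorem mainTheorem7 (G : Subgroup (E3 ≃ᵃⁱ[ℝ] E3)) (hG : IsTypeR3c G) (P : E3) :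
    {F : Set E3 | IsFacet (dirichletStereohedron G P) F}.encard ≤ 79 ∧
      {Q : E3 | IsNeighbor G P Q}.encard ≤ 79 := by
  obtain ⟨hfin, hle⟩ := hG.isLocallyFinite_and_encard_le P
  have h79 : (78 : ℕ∞) ≤ 79 := by norm_num
  refine ⟨(encard_facets_le hfin P).trans (hle.trans h79),
    (Set.encard_mono fun Q hQ => ?_).trans (hle.trans h79)⟩
  exact strictlyAdjacent_of_isNeighbor hfin ⟨1, one_mem G, rfl⟩ hQ
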